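/- Let $K$ be a finite extension of $\mathbb{Q}_p$ with its $p$-adic absolute value $|\cdot|$, $R$ its ring of integers and $k$ its residue field. For $n\ge 0$ let $\mathbb{T}_n^\dagger\subseteq R[[\xi_1,\dots,\xi_n]]$ be the $R$-algebra of power series $\sum_v c_v\xi^v$ for which there is $\varepsilon>0$ with $|c_v|p^{\varepsilon|v|}\to 0$. Let $A$ be a weakly complete finitely generated $R$-algebra, that is, $A\cong\mathbb{T}_n^\dagger/I$ for some $n$ and some ideal $I$, and assume that $A$ is flat over $R$. Put $A\langle\xi\rangle^\dagger=\mathbb{T}_{n+1}^\dagger/I\,\mathbb{T}_{n+1}^\dagger$ (with $\xi=\xi_{n+1}$), and, for $h\in A$, $A\langle h^{-1}\rangle^\dagger=A\langle\xi\rangle^\dagger/(h\xi-1)$; for $b=ag$ in $A$ the restriction map $A\langle a^{-1}\rangle^\dagger\to A\langle b^{-1}\rangle^\dagger$ is the homomorphism of $A$-algebras induced by the substitution $\xi\mapsto g\xi$. Let $f\in A$ and let $f_1,\dots,f_r$ be elements of the ideal $(f)$ such that, in $A\otimes_R k$, the image $\bar f$ of $f$ lies in the radical $\sqrt{(\bar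 f_1,\dots,\bar f_r)}$ of the ideal generated by the images of the $f_i$. Then for every $A$-module $M$ the sequence $$0\to A\langle f^{-1}\rangle^\dagger\otimes_A M\to\prod_i A\langle f_i^{-1}\rangle^\dagger\otimes_A M\rightrightarrows\prod_{i,j}A\langle (f_if_j)^{-1}\rangle^\dagger\otimes_A M,$$ whose arrows are given by the restriction maps, is exact: the first map is injective, and its image is the set of elements on which the two maps to the last term (restricting the $i$-th, respectively the $j$-th, component) agree. -/

import Mathlib

open Filter Topology TensorProduct

noncomputable section

namespace DaggerAlgebra

/-- The ring of integers `R = {x : ‖x‖ ≤ 1}` of a nonarchimedean normed field `K`. -/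
abbrev RInt (K : Type*) [NormedField K] [IsUltrametricDist K] : ValuationSubring K :=
  (NormedField.valuation (K := K)).valuationSubring

section Overconvergent

variable {K : Type*} [NormedField K] [IsUltrametricDist K] {σ τ : Type*}

theorem norm_coe_le_one (x : RInt K) : ‖(x : K)‖ ≤ 1 := x.2

/-- All coefficients satisfy `|c_v| ρ^|v| ≤ C`. -/
def Bounded (ρ C : ℝ) (F : MvPowerSeries σ (RInt K)) : Prop :=
  ∀ v : σ →₀ ℕ, ‖((MvPowerSeries.coeff v F : RInt K) : K)‖ * ρ ^ v.degree ≤ C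

/-- The overconvergence condition: there is `ε > 0` such that `|c_v| p^(ε|v|) → 0` as `|v| → ∞`. -/
def IsOverconvergent (p : ℕ) (F : MvPowerSeries σ (RInt K)) : Prop :=
  ∃ ε : ℝ, 0 < ε ∧
    Tendsto (fun v : σ →₀ ℕ => ‖((MvPowerSeries.coeff v F : RInt K) : K)‖ * (p : ℝ) ^ (ε * (v.degree : ℝ)))
      cofinite (𝓝 0)

theorem isOverconvergent_iff [Finite σ] (p : ℕ) [hp : Fact p.Prime]
    (F : MvPowerSeries σ (RInt K)) :
    IsOverconvergent p F ↔ ∃ ρ C : ℝ, 1 < ρ ∧ Bounded ρ C F := by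
  have hp1 : (1 : ℝ) < p := by exact_mod_cast hp.out.one_lt
  have hp0 : (0 : ℝ) < p := by linarith
  constructor
  · rintro ⟨ε, hε, h⟩
    obtain ⟨C, hC⟩ := h.bddAbove_range_of_cofinite
    refine ⟨(p : ℝ) ^ ε, C, Real.one_lt_rpow hp1 hε, fun v => ?_⟩
    rw [← Real.rpow_natCast, ← Real.rpow_mul hp0.le]
    exact hC ⟨v, rfl⟩
  · rintro ⟨ρ, C, hρ, h⟩
    have hρ0 : 0 < ρ := by linarith
    have hl : 0 < Real.logb p ρ := Real.logb_pos hp1 hρ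
    refine ⟨Real.logb p ρ / 2, by positivity, ?_⟩
    set s : ℝ := (p : ℝ) ^ (-(Real.logb p ρ / 2)) with hs
    have hs0 : 0 < s := Real.rpow_pos_of_pos hp0 _
    have hs1 : s < 1 := Real.rpow_lt_one_of_one_lt_of_neg hp1 (by linarith)
    have key : ∀ v : σ →₀ ℕ, (p : ℝ) ^ (Real.logb p ρ / 2 * (v.degree : ℝ))
        = ρ ^ v.degree * s ^ v.degree := by
      intro v
      rw [← mul_pow, Real.rpow_mul hp0.le, Real.rpow_natCast]
      congr 1
      nth_rewrite 2 [← Real.rpow_logb hp0 hp1.ne' hρ0]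
      rw [hs, ← Real.rpow_add hp0]
      congr 1
      ring
    have hdeg : Tendsto (fun v : σ →₀ ℕ => v.degree) cofinite atTop := by
      rw [← Nat.cofinite_eq_atTop]
      refine Tendsto.cofinite_of_finite_preimage_singleton fun b => ?_
      exact Finsupp.finite_of_degree_eq b
    have hlim : Tendsto (fun v : σ →₀ ℕ => C * s ^ v.degree) cofinite (𝓝 0) := by
      have := ((tendsto_pow_atTop_nhds_zero_of_lt_one hs0.le hs1).comp hdeg).const_mul C
      simpa using this
    refine squeeze_zero (fun v => by positivity) (fun v => ?_) hlim
    rw [key, ← mul_assoc]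
    exact mul_le_mul_of_nonneg_right (h v) (by positivity)

theorem Bounded.nonneg {ρ C : ℝ} {F : MvPowerSeries σ (RInt K)} (h : Bounded ρ C F) : 0 ≤ C := by
  have := h 0
  simp only [map_zero, pow_zero, mul_one] at this
  exact (norm_nonneg _).trans this

theorem Bounded.mono {ρ ρ' C C' : ℝ} {F : MvPowerSeries σ (RInt K)} (h : Bounded ρ C F)
    (h0 : 0 ≤ ρ') (hρ : ρ' ≤ ρ) (hC : C ≤ C') : Bounded ρ' C' F := fun v =>
  (mul_le_mul_of_nonneg_left (pow_le_pow_left₀ h0 hρ _) (norm_nonneg _)).trans ((h v).trans hC)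

theorem Bounded.add {ρ C : ℝ} {F G : MvPowerSeries σ (RInt K)} (h0 : 0 ≤ ρ)
    (hF : Bounded ρ C F) (hG : Bounded ρ C G) : Bounded ρ C (F + G) := by
  intro v
  rw [map_add]
  push_cast
  refine (mul_le_mul_of_nonneg_right (IsUltrametricDist.norm_add_le_max _ _)
    (pow_nonneg h0 _)).trans ?_
  rw [max_mul_of_nonneg _ _ (pow_nonneg h0 _)]
  exact max_le (hF v) (hG v)

theorem Bounded.mul {ρ C D : ℝ} {F G : MvPowerSeries σ (RInt K)} (h0 : 0 ≤ ρ)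
    (hF : Bounded ρ C F) (hG : Bounded ρ D G) : Bounded ρ (C * D) (F * G) := by
  classical
  intro v
  rw [MvPowerSeries.coeff_mul]
  push_cast
  have hC := hF.nonneg
  have hD := hG.nonneg
  rw [← abs_of_nonneg (pow_nonneg h0 v.degree), ← abs_norm, ← abs_mul,
    abs_of_nonneg (mul_nonneg (norm_nonneg _) (pow_nonneg h0 _))]
  obtain ⟨i, hi, hle⟩ := IsUltrametricDist.exists_norm_finsetSum_le
    (Finset.HasAntidiagonal.antidiagonal v)
    (fun q : (σ →₀ ℕ) × (σ →₀ ℕ) =>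
      ((MvPowerSeries.coeff q.1 F : RInt K) : K) * ((MvPowerSeries.coeff q.2 G : RInt K) : K))
  have hne : (Finset.HasAntidiagonal.antidiagonal v).Nonempty := ⟨(0, v), by simp⟩
  have hi' := Finset.HasAntidiagonal.mem_antidiagonal.1 (hi hne)
  refine (mul_le_mul_of_nonneg_right hle (pow_nonneg h0 _)).trans ?_
  rw [norm_mul, ← hi', map_add, pow_add, mul_mul_mul_comm]
  exact mul_le_mul (hF _) (hG _) (mul_nonneg (norm_nonneg _) (pow_nonneg h0 _)) hC

theorem bounded_C (ρ : ℝ) (r : RInt K) : Bounded ρ 1 (MvPowerSeries.C (σ := σ) r) := by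
  classical
  intro v
  rw [MvPowerSeries.coeff_C]
  split_ifs with hv
  · simpa [hv] using norm_coe_le_one r
  · simp

theorem bounded_one (ρ : ℝ) : Bounded ρ 1 (1 : MvPowerSeries σ (RInt K)) := by
  simpa using bounded_C (σ := σ) ρ (1 : RInt K)

theorem Bounded.pow {ρ C : ℝ} {F : MvPowerSeries σ (RInt K)} (h0 : 0 ≤ ρ)
    (hF : Bounded ρ C F) (n : ℕ) : Bounded ρ (C ^ n) (F ^ n) := by
  induction n with
  | zero => simpa using bounded_one ρ
  | succ n ih => rw [pow_succ, pow_succ]; exact ih.mul h0 hF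

theorem Bounded.prod {ρ C : ℝ} (h0 : 0 ≤ ρ) {a : σ → MvPowerSeries τ (RInt K)}
    (ha : ∀ s, Bounded ρ C (a s)) (d : σ →₀ ℕ) :
    Bounded ρ (C ^ d.degree) (d.prod fun s m => a s ^ m) := by
  classical
  rw [Finsupp.degree_apply, Finsupp.prod]
  induction d.support using Finset.induction_on with
  | empty => simpa using bounded_one ρ
  | insert s t hs ih =>
    rw [Finset.prod_insert hs, Finset.sum_insert hs, pow_add]
    exact ((ha s).pow h0 _).mul h0 ih

theorem bounded_X (ρ : ℝ) (h : 1 ≤ ρ) (s : σ) :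
    Bounded ρ ρ (MvPowerSeries.X s : MvPowerSeries σ (RInt K)) := by
  classical
  intro v
  rw [MvPowerSeries.coeff_X]
  split_ifs with hv
  · simp [hv]
  · simp; linarith

/-- Shrinking the radius makes the bound as close to `1` as we like. -/
theorem Bounded.shrink {ρ C : ℝ} {F : MvPowerSeries σ (RInt K)} (hρ : 1 < ρ)
    (hF : Bounded ρ C F) {B : ℝ} (hB : 1 < B) : ∃ ρ', 1 < ρ' ∧ Bounded ρ' B F := by
  have hρ0 : 0 ≤ ρ := by linarith
  have hF' : Bounded ρ (max C 1) F := hF.mono hρ0 le_rfl (le_max_left _ _)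
  set D := max C 1 with hD
  have hD1 : 1 ≤ D := le_max_right _ _
  have hD0 : 0 < D := by linarith
  have hlim : Tendsto (fun t : ℝ => D ^ t) (𝓝[>] 0) (𝓝 1) := by
    have h1 : Tendsto (fun t : ℝ => D ^ t) (𝓝 0) (𝓝 (D ^ (0 : ℝ))) :=
      (Real.continuous_const_rpow hD0.ne').tendsto 0
    rw [Real.rpow_zero] at h1
    exact h1.mono_left nhdsWithin_le_nhds
  have hev : ∀ᶠ t : ℝ in 𝓝[>] 0, D ^ t < B ∧ 0 < t ∧ t < 1 :=
    (hlim.eventually (gt_mem_nhds hB)).and (Ioo_mem_nhdsGT one_pos)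
  obtain ⟨t, htB, ht0, ht1⟩ := hev.exists
  refine ⟨ρ ^ t, Real.one_lt_rpow hρ ht0, fun v => ?_⟩
  refine le_trans ?_ htB.le
  have hx0 := norm_nonneg ((MvPowerSeries.coeff v F : RInt K) : K)
  have hx : ‖((MvPowerSeries.coeff v F : RInt K) : K)‖
      ≤ ‖((MvPowerSeries.coeff v F : RInt K) : K)‖ ^ t :=
    Real.self_le_rpow_of_le_one hx0 (norm_coe_le_one _) ht1.le
  have hpow : (ρ ^ t) ^ v.degree = (ρ ^ v.degree) ^ t := by
    rw [← Real.rpow_natCast, ← Real.rpow_natCast, ← Real.rpow_mul hρ0, ← Real.rpow_mul hρ0,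
      mul_comm]
  rw [hpow]
  refine (mul_le_mul_of_nonneg_right hx (by positivity)).trans ?_
  rw [← Real.mul_rpow hx0 (by positivity)]
  exact Real.rpow_le_rpow (by positivity) (hF' v) ht0.le

/-- Overconvergence is stable under substitution of finitely many overconvergent series. -/
theorem Bounded.subst {ρ B C : ℝ} {F : MvPowerSeries σ (RInt K)} (hF : Bounded B C F)
    (h0 : 0 ≤ ρ) {a : σ → MvPowerSeries τ (RInt K)}
    (has : MvPowerSeries.HasSubst a) (ha : ∀ s, Bounded ρ B (a s)) :
    Bounded ρ C (MvPowerSeries.subst a F) := by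
  classical
  intro e
  rw [MvPowerSeries.coeff_subst has, finsum_eq_sum _ (MvPowerSeries.coeff_subst_finite has F e)]
  push_cast
  have hC := hF.nonneg
  set S := (MvPowerSeries.coeff_subst_finite has F e).toFinset
  rcases S.eq_empty_or_nonempty with hS | hS
  · simpa [hS] using hC
  obtain ⟨d, -, hle⟩ := IsUltrametricDist.exists_norm_finsetSum_le S
    (fun d : σ →₀ ℕ => ((MvPowerSeries.coeff d F •
      MvPowerSeries.coeff e (d.prod fun s m => a s ^ m) : RInt K) : K))
  refine (mul_le_mul_of_nonneg_right hle (pow_nonneg h0 _)).trans ?_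
  rw [smul_eq_mul]
  push_cast
  rw [norm_mul, mul_assoc]
  exact (mul_le_mul_of_nonneg_left (Bounded.prod h0 ha d e) (norm_nonneg _)).trans (hF d)

theorem exists_common_bound [Finite σ] {p : ℕ} [Fact p.Prime] [Finite τ]
    {a : σ → MvPowerSeries τ (RInt K)}
    (ha : ∀ s, IsOverconvergent p (a s)) {B : ℝ} (hB : 1 < B) :
    ∃ ρ, 1 < ρ ∧ ∀ s, Bounded ρ B (a s) := by
  have h1 : ∀ s, ∃ ρ, 1 < ρ ∧ Bounded ρ B (a s) := fun s => by
    obtain ⟨ρ, C, hρ, h⟩ := (isOverconvergent_iff p _).1 (ha s)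
    exact h.shrink hρ hB
  choose r hr hb using h1
  rcases isEmpty_or_nonempty σ with hσ | hσ
  · exact ⟨2, by norm_num, fun s => isEmptyElim s⟩
  · obtain ⟨s₀, hs₀⟩ := Finite.exists_min r
    exact ⟨r s₀, hr s₀, fun s => (hb s).mono (by linarith [hr s₀]) (hs₀ s) le_rfl⟩

end Overconvergent

/-- The algebra `T_n†` of overconvergent power series in `n` variables over `R`, as a subalgebra
of `R[[ξ_1, …, ξ_n]]`. -/
def daggerSubalgebra (p : ℕ) [Fact p.Prime] (K : Type*) [NormedField K] [IsUltrametricDist K]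
    (n : ℕ) : Subalgebra (RInt K) (MvPowerSeries (Fin n) (RInt K)) where
  carrier := {F | IsOverconvergent p F}
  mul_mem' := by
    intro F G hF hG
    obtain ⟨ρ, C, hρ, hF⟩ := (isOverconvergent_iff p F).1 hF
    obtain ⟨ρ', C', hρ', hG⟩ := (isOverconvergent_iff p G).1 hG
    have h1 : 1 < min ρ ρ' := lt_min hρ hρ'
    have h0 : 0 ≤ min ρ ρ' := by linarith
    exact (isOverconvergent_iff p _).2 ⟨min ρ ρ', _, h1,
      (hF.mono h0 (min_le_left _ _) le_rfl).mul h0 (hG.mono h0 (min_le_right _ _) le_rfl)⟩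
  add_mem' := by
    intro F G hF hG
    obtain ⟨ρ, C, hρ, hF⟩ := (isOverconvergent_iff p F).1 hF
    obtain ⟨ρ', C', hρ', hG⟩ := (isOverconvergent_iff p G).1 hG
    have h1 : 1 < min ρ ρ' := lt_min hρ hρ'
    have h0 : 0 ≤ min ρ ρ' := by linarith
    exact (isOverconvergent_iff p _).2 ⟨min ρ ρ', _, h1,
      (hF.mono h0 (min_le_left _ _) (le_max_left C C')).add h0
        (hG.mono h0 (min_le_right _ _) (le_max_right C C'))⟩
  algebraMap_mem' := fun r =>
    (isOverconvergent_iff p _).2 ⟨2, 1, by norm_num, bounded_C 2 r⟩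

/-- `T_n†` as a ring (an `R`-algebra). -/
abbrev Dagger (p : ℕ) [Fact p.Prime] (K : Type*) [NormedField K] [IsUltrametricDist K]
    (n : ℕ) : Type _ := daggerSubalgebra p K n

section Substitution

variable {p : ℕ} [Fact p.Prime] {K : Type*} [NormedField K] [IsUltrametricDist K] {n m : ℕ}

theorem mem_daggerSubalgebra {F : MvPowerSeries (Fin n) (RInt K)} :
    F ∈ daggerSubalgebra p K n ↔ IsOverconvergent p F := Iff.rfl

/-- The variable `ξ_i` of `T_n†`. -/
def Dagger.X (i : Fin n) : Dagger p K n :=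
  ⟨MvPowerSeries.X i, (isOverconvergent_iff p _).2 ⟨2, 2, by norm_num, bounded_X 2 (by norm_num) i⟩⟩

theorem Dagger.hasSubst {a : Fin n → Dagger p K m}
    (ha : ∀ i, MvPowerSeries.constantCoeff (a i).1 = 0) :
    MvPowerSeries.HasSubst (fun i => (a i).1) :=
  MvPowerSeries.hasSubst_of_constantCoeff_zero ha

/-- Substitution `F(ξ_1, …, ξ_n) ↦ F(a_1, …, a_n)` of overconvergent series `a_i` without constant
term into overconvergent series. -/
def Dagger.subst (a : Fin n → Dagger p K m)
    (ha : ∀ i, MvPowerSeries.constantCoeff (a i).1 = 0) : Dagger p K n →ₐ[RInt K] Dagger p K m :=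
  ((MvPowerSeries.substAlgHom (Dagger.hasSubst ha)).comp (daggerSubalgebra p K n).val).codRestrict
    (daggerSubalgebra p K m) (fun F => by
      obtain ⟨B, C, hB, hF⟩ := (isOverconvergent_iff p F.1).1 F.2
      obtain ⟨ρ, hρ, hb⟩ := exists_common_bound (p := p) (fun i => (a i).2) hB
      refine mem_daggerSubalgebra.2 ((isOverconvergent_iff p _).2 ⟨ρ, C, hρ, ?_⟩)
      have := hF.subst (by linarith) (Dagger.hasSubst ha) hb
      simpa only [AlgHom.comp_apply, Subalgebra.coe_val, MvPowerSeries.substAlgHom_apply] using this)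

theorem Dagger.coe_subst (a : Fin n → Dagger p K m)
    (ha : ∀ i, MvPowerSeries.constantCoeff (a i).1 = 0) (F : Dagger p K n) :
    (Dagger.subst a ha F).1 = MvPowerSeries.subst (fun i => (a i).1) F.1 :=
  MvPowerSeries.substAlgHom_apply (Dagger.hasSubst ha) F.1

theorem Dagger.subst_X (a : Fin n → Dagger p K m)
    (ha : ∀ i, MvPowerSeries.constantCoeff (a i).1 = 0) (i : Fin n) :
    Dagger.subst a ha (Dagger.X i) = a i :=
  Subtype.ext <| (Dagger.coe_subst a ha _).trans (MvPowerSeries.subst_X (Dagger.hasSubst ha) i)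

/-- The inclusion `T_n† → T_{n+1}†`, `ξ_i ↦ ξ_i` for `i ≤ n`. -/
def Dagger.incl (p : ℕ) [Fact p.Prime] (K : Type*) [NormedField K] [IsUltrametricDist K] (n : ℕ) :
    Dagger p K n →ₐ[RInt K] Dagger p K (n + 1) :=
  Dagger.subst (fun i => Dagger.X i.castSucc) (fun _ => MvPowerSeries.constantCoeff_X _)

/-- `T_{n+1}†` is a `T_n†`-algebra through the inclusion of the first `n` variables. -/
instance Dagger.algebraSucc : Algebra (Dagger p K n) (Dagger p K (n + 1)) :=
  (Dagger.incl p K n).toRingHom.toAlgebra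

/-- The tuple `(ξ_1, …, ξ_n, G ξ)` in `T_{n+1}†`, for `G ∈ T_n†` and `ξ` the last variable. -/
def Dagger.scaleVec (G : Dagger p K n) : Fin (n + 1) → Dagger p K (n + 1) :=
  Fin.lastCases (algebraMap (Dagger p K n) (Dagger p K (n + 1)) G * Dagger.X (Fin.last n))
    (fun i => Dagger.X i.castSucc)

theorem Dagger.constantCoeff_scaleVec (G : Dagger p K n) (i : Fin (n + 1)) :
    MvPowerSeries.constantCoeff (Dagger.scaleVec G i).1 = 0 := by
  induction i using Fin.lastCases with
  | last => simp [Dagger.scaleVec, Dagger.X]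
  | cast i => simp [Dagger.scaleVec, Dagger.X]

theorem Dagger.subst_scaleVec_incl (G F : Dagger p K n) :
    Dagger.subst (Dagger.scaleVec G) (Dagger.constantCoeff_scaleVec G) (Dagger.incl p K n F) =
      Dagger.incl p K n F := by
  have h1 : ∀ i : Fin n, MvPowerSeries.constantCoeff
      (Dagger.X i.castSucc : Dagger p K (n + 1)).1 = 0 :=
    fun _ => MvPowerSeries.constantCoeff_X _
  have h2 : (Dagger.incl p K n F).1 = MvPowerSeries.subst
      (fun i : Fin n => (Dagger.X i.castSucc : Dagger p K (n + 1)).1) F.1 :=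
    Dagger.coe_subst _ h1 F
  apply Subtype.ext
  rw [Dagger.coe_subst, h2, MvPowerSeries.subst_comp_subst_apply (Dagger.hasSubst h1)
    (Dagger.hasSubst (Dagger.constantCoeff_scaleVec G))]
  congr 1
  funext i
  refine (MvPowerSeries.subst_X (Dagger.hasSubst (Dagger.constantCoeff_scaleVec G)) _).trans ?_
  simp [Dagger.scaleVec]

/-- For `G ∈ T_n†`, the endomorphism of the `T_n†`-algebra `T_{n+1}†` that sends the last variable
`ξ` to `G ξ`, that is `F(ξ_1, …, ξ_n, ξ) ↦ F(ξ_1, …, ξ_n, G ξ)`. -/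
def Dagger.scale (G : Dagger p K n) :
    Dagger p K (n + 1) →ₐ[Dagger p K n] Dagger p K (n + 1) :=
  { (Dagger.subst (Dagger.scaleVec G) (Dagger.constantCoeff_scaleVec G)).toRingHom with
    commutes' := Dagger.subst_scaleVec_incl G }

theorem Dagger.scale_X_castSucc (G : Dagger p K n) (i : Fin n) :
    Dagger.scale G (Dagger.X i.castSucc) = Dagger.X i.castSucc := by
  refine (Dagger.subst_X _ (Dagger.constantCoeff_scaleVec G) _).trans ?_
  simp [Dagger.scaleVec]

theorem Dagger.scale_X_last (G : Dagger p K n) :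
    Dagger.scale G (Dagger.X (Fin.last n)) =
      algebraMap (Dagger p K n) (Dagger p K (n + 1)) G * Dagger.X (Fin.last n) := by
  refine (Dagger.subst_X _ (Dagger.constantCoeff_scaleVec G) _).trans ?_
  simp [Dagger.scaleVec]

end Substitution

section Localization

variable (p : ℕ) [Fact p.Prime] (K : Type*) [NormedField K] [IsUltrametricDist K] (n : ℕ)
  {A : Type*} [CommRing A] [Algebra (Dagger p K n) A]

variable (A) in
/-- `A⟨ξ⟩†` for a homomorphic image `A = T_n†/I` of `T_n†`: the ring
`T_{n+1}†/I T_{n+1}† = A ⊗_{T_n†} T_{n+1}†`. -/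
abbrev Adjoin : Type _ := A ⊗[Dagger p K n] Dagger p K (n + 1)

variable (A) in
/-- The variable `ξ` of `A⟨ξ⟩†`. -/
def Adjoin.var : Adjoin p K n A := 1 ⊗ₜ[Dagger p K n] Dagger.X (Fin.last n)

/-- The ideal `(f ξ - 1)` of `A⟨ξ⟩†`. -/
def locIdeal (f : A) : Ideal (Adjoin p K n A) :=
  Ideal.span {algebraMap A (Adjoin p K n A) f * Adjoin.var p K n A - 1}

/-- `A⟨f⁻¹⟩† = A⟨ξ⟩†/(f ξ - 1)`. -/
def Loc (f : A) : Type _ := Adjoin p K n A ⧸ locIdeal p K n f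

instance Loc.commRing (f : A) : CommRing (Loc p K n f) :=
  inferInstanceAs (CommRing (Adjoin p K n A ⧸ locIdeal p K n f))

instance Loc.algebra (f : A) : Algebra A (Loc p K n f) :=
  inferInstanceAs (Algebra A (Adjoin p K n A ⧸ locIdeal p K n f))

/-- The quotient map `A⟨ξ⟩† → A⟨f⁻¹⟩†`. -/
def Loc.mk (f : A) : Adjoin p K n A →ₐ[A] Loc p K n f :=
  Ideal.Quotient.mkₐ A (locIdeal p K n f)

theorem Loc.mk_surjective (f : A) : Function.Surjective (Loc.mk p K n f) :=
  Ideal.Quotient.mk_surjective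

theorem Loc.mk_eq_zero_iff (f : A) (x : Adjoin p K n A) :
    Loc.mk p K n f x = 0 ↔ x ∈ locIdeal p K n f :=
  Ideal.Quotient.eq_zero_iff_mem

variable (A) in
/-- The `A`-algebra endomorphism of `A⟨ξ⟩†` with `ξ ↦ g ξ`, where `g` is the image of `G`. -/
def Adjoin.scale (G : Dagger p K n) : Adjoin p K n A →ₐ[A] Adjoin p K n A :=
  Algebra.TensorProduct.map (AlgHom.id A A) (Dagger.scale G)

theorem Adjoin.scale_var (G : Dagger p K n) :
    Adjoin.scale p K n A G (Adjoin.var p K n A) =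
      algebraMap A (Adjoin p K n A) (algebraMap (Dagger p K n) A G) * Adjoin.var p K n A := by
  rw [Adjoin.scale, Adjoin.var, Algebra.TensorProduct.map_tmul, Dagger.scale_X_last, map_one,
    Algebra.TensorProduct.algebraMap_apply, Algebra.algebraMap_self_apply,
    Algebra.TensorProduct.tmul_one_eq_one_tmul, Algebra.TensorProduct.tmul_mul_tmul, mul_one]

variable {p K n}

/-- The homomorphism `A⟨a⁻¹⟩† → A⟨b⁻¹⟩†` of `A`-algebras for `b = a g`, induced by
`ξ ↦ g ξ`, i.e. `a⁻¹ ↦ g b⁻¹`, where `g` is the image of `G ∈ T_n†`. -/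
def Loc.resOf {a b : A} (G : Dagger p K n) (h : b = a * algebraMap (Dagger p K n) A G) :
    Loc p K n a →ₐ[A] Loc p K n b :=
  Ideal.Quotient.liftₐ (locIdeal p K n a) ((Loc.mk p K n b).comp (Adjoin.scale p K n A G)) (by
    have hle : locIdeal p K n a ≤
        RingHom.ker ((Loc.mk p K n b).comp (Adjoin.scale p K n A G)) := by
      rw [locIdeal, Ideal.span_le, Set.singleton_subset_iff]
      change Loc.mk p K n b (Adjoin.scale p K n A G _) = 0
      rw [Loc.mk_eq_zero_iff, map_sub, map_mul, AlgHom.commutes, map_one, Adjoin.scale_var,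
        ← mul_assoc, ← map_mul, ← h]
      exact Ideal.subset_span rfl
    exact fun x hx => hle hx)

theorem Loc.resOf_mk {a b : A} (G : Dagger p K n) (h : b = a * algebraMap (Dagger p K n) A G)
    (x : Adjoin p K n A) :
    Loc.resOf G h (Loc.mk p K n a x) = Loc.mk p K n b (Adjoin.scale p K n A G x) := rfl

theorem exists_factor (hA : Function.Surjective (algebraMap (Dagger p K n) A)) {a b : A}
    (h : a ∣ b) : ∃ G : Dagger p K n, b = a * algebraMap (Dagger p K n) A G := by
  obtain ⟨g, hg⟩ := h
  obtain ⟨G, hG⟩ := hA g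
  exact ⟨G, by rw [hG, hg]⟩

/-- The canonical restriction homomorphism `A⟨a⁻¹⟩† → A⟨b⁻¹⟩†` for `a ∣ b`. -/
def Loc.res (hA : Function.Surjective (algebraMap (Dagger p K n) A)) {a b : A} (h : a ∣ b) :
    Loc p K n a →ₐ[A] Loc p K n b :=
  Loc.resOf (exists_factor hA h).choose (exists_factor hA h).choose_spec

/-- The class of `ξ` in `A⟨b⁻¹⟩†`. -/
def Loc.var (b : A) : Loc p K n b := Loc.mk p K n b (Adjoin.var p K n A)

/-- In `A⟨b⁻¹⟩†` the element `b` is invertible, with inverse the class of `ξ`. -/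
theorem Loc.mul_var (b : A) : algebraMap A (Loc p K n b) b * Loc.var b = 1 := by
  have h := (Loc.mk_eq_zero_iff p K n b _).2 (Ideal.subset_span rfl)
  rw [map_sub, map_mul, map_one, AlgHom.commutes] at h
  exact sub_eq_zero.1 h

/-- The restriction sends the inverse of `a` to the inverse of `a`: if `b = a g`, for any `g`, then
`ξ ↦ g ξ`. -/
theorem Loc.res_var (hA : Function.Surjective (algebraMap (Dagger p K n) A)) {a b : A} (h : a ∣ b)
    (g : A) (hg : b = a * g) :
    Loc.res hA h (Loc.var a) = algebraMap A (Loc p K n b) g * Loc.var b := by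
  have h1 := congrArg (Loc.res hA h) (Loc.mul_var (p := p) (K := K) (n := n) a)
  rw [map_mul, AlgHom.commutes, map_one] at h1
  have h2 := Loc.mul_var (p := p) (K := K) (n := n) b
  have h3 := congrArg (algebraMap A (Loc p K n b)) hg
  rw [map_mul] at h3
  rw [h3] at h2
  linear_combination (algebraMap A (Loc p K n b) g * Loc.var b) * h1
    - (Loc.res hA h (Loc.var a)) * h2

/-- The map `A⟨a⁻¹⟩† ⊗_A M → A⟨b⁻¹⟩† ⊗_A M` for `a ∣ b`. -/
def Loc.resTensor (hA : Function.Surjective (algebraMap (Dagger p K n) A)) {a b : A} (h : a ∣ b)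
    (M : Type*) [AddCommGroup M] [Module A M] :
    Loc p K n a ⊗[A] M →ₗ[A] Loc p K n b ⊗[A] M :=
  (Loc.res hA h).toLinearMap.rTensor M

section Cech

variable (hA : Function.Surjective (algebraMap (Dagger p K n) A))
  {r : ℕ} (M : Type*) [AddCommGroup M] [Module A M]

/-- `A⟨f⁻¹⟩† ⊗ M → ∏_i A⟨f_i⁻¹⟩† ⊗ M`. -/
def cechAug {f : A} {g : Fin r → A} (hg : ∀ i, f ∣ g i) :
    Loc p K n f ⊗[A] M →ₗ[A] ((i : Fin r) → Loc p K n (g i) ⊗[A] M) :=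
  LinearMap.pi fun i => Loc.resTensor hA (hg i) M

/-- The map `∏_i A⟨f_i⁻¹⟩† ⊗ M → ∏_{i,j} A⟨(f_i f_j)⁻¹⟩† ⊗ M` restricting the `i`-th component. -/
def cechLeft (g : Fin r → A) :
    ((i : Fin r) → Loc p K n (g i) ⊗[A] M) →ₗ[A]
      ((q : Fin r × Fin r) → Loc p K n (g q.1 * g q.2) ⊗[A] M) :=
  LinearMap.pi fun q => Loc.resTensor hA (dvd_mul_right (g q.1) (g q.2)) M ∘ₗ LinearMap.proj q.1

/-- The map `∏_i A⟨f_i⁻¹⟩† ⊗ M → ∏_{i,j} A⟨(f_i f_j)⁻¹⟩† ⊗ M` restricting the `j`-th component. -/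
def cechRight (g : Fin r → A) :
    ((i : Fin r) → Loc p K n (g i) ⊗[A] M) →ₗ[A]
      ((q : Fin r × Fin r) → Loc p K n (g q.1 * g q.2) ⊗[A] M) :=
  LinearMap.pi fun q => Loc.resTensor hA (dvd_mul_left (g q.2) (g q.1)) M ∘ₗ LinearMap.proj q.2

end Cech

end Localization

end DaggerAlgebra

end

/-!
Write `a` for a uniformizer of `R`. The functor `M ↦ A⟨f⁻¹⟩† ⊗ M` commutes with direct limits, so
both assertions reduce to finitely generated `M`, with generators `e_1, …, e_m`. Then
`A⟨f⁻¹⟩† ⊗ M` is the quotient of `(T_{n+1}†)^m` by the kernel of the map `tensorTuple e f`, which sends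
`(y_l)` to `∑ y_l ⊗ e_l`, and everything is said in terms of overconvergent series and bounds
`|c_v| ρ^|v| ≤ C` of their coefficients (`Bounded ρ C`).

Three facts carry the argument.

* Division (`exists_bounded_division`). Let `N` be a submodule of a finite free `T_n†`-module. If `z`
  is congruent modulo `N` to a multiple of `a^J`, then it is congruent to some `a^J z'`, where the
  bound of `z'` on a fixed polydisc is at most `B^J` times that of `z`. The vectors of polynomials
  whose multiples by `a^s` lie in `N + (a^(s+1))` form an increasing chain, stationary because
  polynomial rings over `R` are noetherian, and division by lifts of their leading forms does not
  raise degrees. It follows that `N` is `a`-adically closed (`mem_of_forall_exists_sub_mem`), so that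
  `A⟨f⁻¹⟩† ⊗ M` is `a`-adically separated (`eq_zero_of_forall_mem_multiples`). In particular
  an `A`-algebra homomorphism between localizations is unique (`Loc.algHom_ext`).

* Descent modulo `a^J` (`mem_multiples_of_resTensor_mem`, `exists_approximate_glue`). Modulo `a^J` an
  element of `A⟨f⁻¹⟩† ⊗ M` is a polynomial in `f⁻¹`, that is, a fraction `u / f^D`; the Horner sum
  `∑_{k ≤ D} f^(D-k) y_k` of the coefficients of a representing series `y = ∑ y_k ξ^k` is a numerator
  `u`, and on a multiple `(f ξ - 1) w` it takes the value `-w_D`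
  (`exists_evalTuple_horner`). The hypothesis on the radical makes `f^N - a h` a combination
  `∑ c_i f_i`; it is a unit of `A⟨f⁻¹⟩†`, and its powers are combinations of the `f_i^D`. The classical
  exactness argument for localizations of modules then applies, with `D` linear in `J`.

* Convergence (`exists_limit_of_bounded`). As `D` is linear in `J`, the solutions `P_J` modulo `a^J`
  have bounds that grow at most geometrically in `J`. By descent `P_{J+1} - P_J` is a multiple of
  `a^J` in `A⟨f⁻¹⟩† ⊗ M`; by division it is represented by `a^J z_J` with geometric bounds for the
  `z_J`; and the series `∑ a^J z_J` is overconvergent (`Dagger.exists_series_sum`). Its sum is the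
  required element, and by separatedness it restricts to the given ones exactly.
-/

noncomputable section

namespace DaggerAlgebra

/-! ### Coefficient bounds -/

section Bounds

variable {p : ℕ} [Fact p.Prime] {K : Type*} [NormedField K] [IsUltrametricDist K]
  {σ : Type*} {n : ℕ}

theorem Bounded.neg {ρ C : ℝ} {F : MvPowerSeries σ (RInt K)} (hF : Bounded ρ C F) :
    Bounded ρ C (-F) := by
  intro v
  rw [map_neg]
  push_cast
  rw [norm_neg]
  exact hF v

theorem bounded_zero {ρ C : ℝ} (hC : 0 ≤ C) : Bounded ρ C (0 : MvPowerSeries σ (RInt K)) := by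
  intro v
  simpa using hC

/-- Raising radius and bound to a power `t ≤ 1` preserves a coefficient bound, since the
coefficients have norm at most `1`. -/
theorem Bounded.rpow {ρ C : ℝ} {F : MvPowerSeries σ (RInt K)} (hρ : 0 ≤ ρ)
    (hF : Bounded ρ C F) {t : ℝ} (ht0 : 0 < t) (ht1 : t ≤ 1) : Bounded (ρ ^ t) (C ^ t) F := by
  intro v
  have hx0 := norm_nonneg ((MvPowerSeries.coeff v F : RInt K) : K)
  have hx : ‖((MvPowerSeries.coeff v F : RInt K) : K)‖
      ≤ ‖((MvPowerSeries.coeff v F : RInt K) : K)‖ ^ t :=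
    Real.self_le_rpow_of_le_one hx0 (norm_coe_le_one _) ht1
  have hpow : (ρ ^ t) ^ v.degree = (ρ ^ v.degree) ^ t := by
    rw [← Real.rpow_natCast, ← Real.rpow_natCast, ← Real.rpow_mul hρ, ← Real.rpow_mul hρ,
      mul_comm]
  rw [hpow]
  refine (mul_le_mul_of_nonneg_right hx (by positivity)).trans ?_
  rw [← Real.mul_rpow hx0 (by positivity)]
  exact Real.rpow_le_rpow (by positivity) (hF v) ht0.le

variable (p K n) in
/-- The additive group of the elements of `T_n†` whose coefficients satisfy `|c_v| ρ^|v| ≤ C`. -/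
def boundedSubgroup {ρ C : ℝ} (hρ : 0 ≤ ρ) (hC : 0 ≤ C) : AddSubgroup (Dagger p K n) where
  carrier := {x | Bounded ρ C x.1}
  add_mem' hx hy := Bounded.add hρ hx hy
  zero_mem' := bounded_zero hC
  neg_mem' hx := Bounded.neg hx

theorem Bounded.sub {ρ C : ℝ} {F G : MvPowerSeries σ (RInt K)} (h0 : 0 ≤ ρ)
    (hF : Bounded ρ C F) (hG : Bounded ρ C G) : Bounded ρ C (F - G) := by
  rw [sub_eq_add_neg]
  exact hF.add h0 hG.neg

theorem bounded_sum {ι : Type*} (s : Finset ι) {x : ι → Dagger p K n} {ρ C : ℝ} (hρ : 0 ≤ ρ)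
    (hC : 0 ≤ C) (hx : ∀ i ∈ s, Bounded ρ C (x i).1) : Bounded ρ C (∑ i ∈ s, x i).1 :=
  (boundedSubgroup p K n hρ hC).sum_mem hx

/-- An element of `T_n†` all of whose coefficients are divisible by `a` is divisible by `a`. -/
theorem Dagger.exists_eq_mul (x : Dagger p K n) (a : RInt K) (ha : a ≠ 0)
    (h : ∀ v, ‖((MvPowerSeries.coeff v x.1 : RInt K) : K)‖ ≤ ‖(a : K)‖) :
    ∃ y : Dagger p K n, x = algebraMap (RInt K) (Dagger p K n) a * y ∧
      ∀ ρ C : ℝ, Bounded ρ C x.1 → Bounded ρ (C / ‖(a : K)‖) y.1 := by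
  have ha' : 0 < ‖(a : K)‖ := norm_pos_iff.2 (by simpa using ha)
  have hdiv : ∀ v, ∃ c : RInt K, MvPowerSeries.coeff v x.1 = a * c := by
    intro v
    refine ⟨⟨((MvPowerSeries.coeff v x.1 : RInt K) : K) / a, ?_⟩, ?_⟩
    · have : ‖((MvPowerSeries.coeff v x.1 : RInt K) : K) / a‖ ≤ 1 := by
        rw [norm_div]
        exact div_le_one_of_le₀ (h v) ha'.le
      exact this
    · apply Subtype.ext
      push_cast
      rw [mul_div_cancel₀]
      exact norm_pos_iff.1 ha'
  choose c hc using hdiv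
  have key : ∀ ρ C : ℝ, Bounded ρ C x.1 →
      Bounded ρ (C / ‖(a : K)‖) (c : MvPowerSeries (Fin n) (RInt K)) := by
    intro ρ C hx v
    have h1 := hx v
    rw [hc v] at h1
    push_cast at h1
    rw [norm_mul] at h1
    rw [le_div_iff₀ ha']
    change ‖(c v : K)‖ * _ * _ ≤ _
    linarith
  obtain ⟨ρ, C, hρ, hx⟩ := (isOverconvergent_iff p x.1).1 x.2
  refine ⟨⟨(c : MvPowerSeries (Fin n) (RInt K)),
    (isOverconvergent_iff p _).2 ⟨ρ, _, hρ, key ρ C hx⟩⟩, ?_, key⟩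
  apply Subtype.ext
  change x.1 = MvPowerSeries.C a * _
  ext v
  rw [MvPowerSeries.coeff_C_mul, hc v]
  rfl

theorem Dagger.coeff_algebraMap_mul (a : RInt K) (y : Dagger p K n) (v : Fin n →₀ ℕ) :
    MvPowerSeries.coeff v (algebraMap (RInt K) (Dagger p K n) a * y).1
      = a * MvPowerSeries.coeff v y.1 :=
  MvPowerSeries.coeff_C_mul _ _ _

theorem bounded_algebraMap (ρ : ℝ) (a : RInt K) :
    Bounded ρ 1 (algebraMap (RInt K) (Dagger p K n) a).1 :=
  bounded_C ρ a

/-- `T_n†` is separated for the topology of the powers of an element of norm less than `1`. -/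
theorem Dagger.eq_zero_of_forall_dvd {a : RInt K} (ha : ‖(a : K)‖ < 1) {x : Dagger p K n}
    (h : ∀ J : ℕ, algebraMap (RInt K) (Dagger p K n) a ^ J ∣ x) : x = 0 := by
  apply Subtype.ext
  ext v
  change (((MvPowerSeries.coeff v) x.1 : RInt K) : K) = 0
  have hle : ∀ J : ℕ, ‖((MvPowerSeries.coeff v x.1 : RInt K) : K)‖ ≤ ‖(a : K)‖ ^ J := by
    intro J
    obtain ⟨y, hy⟩ := h J
    rw [hy, ← map_pow, Dagger.coeff_algebraMap_mul]
    push_cast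
    rw [norm_mul, norm_pow]
    exact mul_le_of_le_one_right (by positivity) (norm_coe_le_one _)
  have := ge_of_tendsto' (tendsto_pow_atTop_nhds_zero_of_lt_one (norm_nonneg _) ha) hle
  exact norm_le_zero_iff.1 this

/-- A series `∑ a^j z_j` whose terms have coefficient bounds growing at most geometrically in `j`
at some radius `ρ > 1` has an overconvergent sum. -/
theorem Dagger.exists_series_sum [CompleteSpace K] {a : RInt K} (ha0 : a ≠ 0)
    (ha : ‖(a : K)‖ < 1) {ρ C B : ℝ} (hρ : 1 < ρ) (hB : 1 ≤ B) (z : ℕ → Dagger p K n)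
    (hz : ∀ j, Bounded ρ (C * B ^ j) (z j).1) :
    ∃ s : Dagger p K n, ∀ J : ℕ, ∃ t : Dagger p K n,
      s = ∑ j ∈ Finset.range J, algebraMap (RInt K) (Dagger p K n) a ^ j * z j
        + algebraMap (RInt K) (Dagger p K n) a ^ J * t := by
  have ha' : 0 < ‖(a : K)‖ := norm_pos_iff.2 (by simpa using ha0)
  have hC : 0 ≤ C := by simpa using (hz 0).nonneg
  have hρ0 : 0 ≤ ρ := by linarith
  have hB0 : 0 < B := by linarith
  -- An exponent `t` with `B ^ t ≤ 1 / |a|`: at the radius `ρ ^ t` the terms are uniformly bounded.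
  obtain ⟨t, htB, ht0, ht1⟩ : ∃ t : ℝ, B ^ t < ‖(a : K)‖⁻¹ ∧ 0 < t ∧ t < 1 := by
    have hlim : Tendsto (fun t : ℝ => B ^ t) (𝓝[>] 0) (𝓝 1) := by
      have h1 : Tendsto (fun t : ℝ => B ^ t) (𝓝 0) (𝓝 (B ^ (0 : ℝ))) :=
        (Real.continuous_const_rpow hB0.ne').tendsto 0
      rw [Real.rpow_zero] at h1
      exact h1.mono_left nhdsWithin_le_nhds
    exact ((hlim.eventually (gt_mem_nhds ((one_lt_inv₀ ha').2 ha))).and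
      (Ioo_mem_nhdsGT one_pos)).exists
  set τ : ℝ := ρ ^ t with hτ
  have hτ1 : 1 < τ := Real.one_lt_rpow hρ ht0
  let c : (Fin n →₀ ℕ) → ℕ → K := fun v j =>
    (a : K) ^ j * ((MvPowerSeries.coeff v (z j).1 : RInt K) : K)
  have hc1 : ∀ v j, ‖c v j‖ ≤ ‖(a : K)‖ ^ j := by
    intro v j
    rw [norm_mul, norm_pow]
    exact mul_le_of_le_one_right (by positivity) (norm_coe_le_one _)
  have hc2 : ∀ v j, ‖c v j‖ * τ ^ v.degree ≤ C ^ t := by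
    intro v j
    have h1 := (hz j).rpow hρ0 ht0 ht1.le v
    rw [norm_mul, norm_pow, mul_assoc]
    refine (mul_le_mul_of_nonneg_left h1 (by positivity)).trans ?_
    rw [Real.mul_rpow hC (by positivity), mul_left_comm]
    refine mul_le_of_le_one_right (by positivity) ?_
    have h2 : (B ^ j) ^ t = (B ^ t) ^ j := by
      rw [← Real.rpow_natCast, ← Real.rpow_natCast, ← Real.rpow_mul hB0.le,
        ← Real.rpow_mul hB0.le, mul_comm]
    rw [h2, ← mul_pow]
    refine pow_le_one₀ (by positivity) ?_
    rw [← mul_inv_cancel₀ ha'.ne']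
    exact mul_le_mul_of_nonneg_left htB.le ha'.le
  have hsum : ∀ v, Summable (c v) := by
    intro v
    apply NonarchimedeanAddGroup.summable_of_tendsto_cofinite_zero
    rw [Nat.cofinite_eq_atTop]
    exact squeeze_zero_norm (hc1 v) (tendsto_pow_atTop_nhds_zero_of_lt_one ha'.le ha)
  have htail : ∀ v J, ‖∑' j, c v (j + J)‖ ≤ ‖(a : K)‖ ^ J := by
    intro v J
    refine (IsUltrametricDist.norm_tsum_le _).trans (ciSup_le fun j => (hc1 v _).trans ?_)
    exact pow_le_pow_of_le_one ha'.le ha.le (Nat.le_add_left _ _)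
  have h1 : ∀ v, ‖∑' j, c v j‖ ≤ 1 := fun v => by simpa using htail v 0
  let s : MvPowerSeries (Fin n) (RInt K) := fun v => ⟨∑' j, c v j, h1 v⟩
  have hs : Bounded τ (C ^ t) s := by
    intro v
    change ‖∑' j, c v j‖ * τ ^ v.degree ≤ C ^ t
    have hpos : 0 < τ ^ v.degree := by positivity
    rw [← le_div_iff₀ hpos]
    refine (IsUltrametricDist.norm_tsum_le _).trans (ciSup_le fun j => ?_)
    rw [le_div_iff₀ hpos]
    exact hc2 v j
  let S : Dagger p K n := ⟨s, (isOverconvergent_iff p _).2 ⟨τ, _, hτ1, hs⟩⟩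
  refine ⟨S, fun J => ?_⟩
  obtain ⟨y, hy, -⟩ := Dagger.exists_eq_mul
    (S - ∑ j ∈ Finset.range J, algebraMap (RInt K) (Dagger p K n) a ^ j * z j) (a ^ J)
    (pow_ne_zero _ ha0) (fun v => by
      have h2 : ((MvPowerSeries.coeff v (S - ∑ j ∈ Finset.range J,
          algebraMap (RInt K) (Dagger p K n) a ^ j * z j).1 : RInt K) : K)
          = ∑' j, c v (j + J) := by
        rw [eq_comm, ← add_right_inj, (hsum v).sum_add_tsum_nat_add J]
        have h3 : (S - ∑ j ∈ Finset.range J, algebraMap (RInt K) (Dagger p K n) a ^ j * z j).1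
            = S.1 - ∑ j ∈ Finset.range J, (algebraMap (RInt K) (Dagger p K n) (a ^ j) * z j).1 := by
          push_cast
          rfl
        rw [h3, map_sub, map_sum]
        simp only [Dagger.coeff_algebraMap_mul]
        push_cast
        change _ = _ + ((∑' j, c v j) - _)
        simp only [c]
        ring
      rw [h2]
      push_cast
      rw [norm_pow]
      exact htail v J)
  refine ⟨y, ?_⟩
  rw [← map_pow, ← hy]
  ring

theorem Dagger.exists_bounded (x : Dagger p K n) : ∃ ρ C : ℝ, 1 < ρ ∧ 1 ≤ C ∧ Bounded ρ C x.1 := by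
  obtain ⟨ρ, C, hρ, h⟩ := (isOverconvergent_iff p _).1 x.2
  exact ⟨ρ, max C 1, hρ, le_max_right _ _, h.mono (by linarith) le_rfl (le_max_left _ _)⟩

/-- Elements `1 - a y` with `|a| < 1` are units of `T_n†`: the geometric series is
overconvergent. -/
theorem Dagger.exists_mul_eq_one [CompleteSpace K] {a : RInt K} (ha0 : a ≠ 0)
    (ha : ‖(a : K)‖ < 1) (y : Dagger p K n) :
    ∃ s : Dagger p K n, (1 - algebraMap (RInt K) (Dagger p K n) a * y) * s = 1 := by
  obtain ⟨ρ, C, hρ, hC, hy⟩ := y.exists_bounded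
  obtain ⟨s, hs⟩ := Dagger.exists_series_sum (C := 1) ha0 ha hρ hC (fun j => y ^ j) (fun j => by
    rw [one_mul]
    exact hy.pow (by linarith) j)
  refine ⟨s, sub_eq_zero.1 (Dagger.eq_zero_of_forall_dvd ha fun J => ?_)⟩
  obtain ⟨t, ht⟩ := hs J
  set w := algebraMap (RInt K) (Dagger p K n) a
  have hg : (1 - w * y) * ∑ j ∈ Finset.range J, w ^ j * y ^ j = 1 - w ^ J * y ^ J := by
    simp only [← mul_pow]
    exact mul_neg_geom_sum _ _
  refine ⟨(1 - w * y) * t - y ^ J, ?_⟩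
  rw [ht]
  linear_combination hg

end Bounds

/-! ### Polynomials in the ring of overconvergent series -/

section Polynomials

variable {p : ℕ} [Fact p.Prime] {K : Type*} [NormedField K] [IsUltrametricDist K] {n : ℕ}

/-- Vanishing of all coefficients in degrees `≥ D` bounds the coefficients at every radius. -/
theorem bounded_of_degree_lt {ρ : ℝ} (hρ : 1 ≤ ρ) {D : ℕ} {F : MvPowerSeries (Fin n) (RInt K)}
    (h : ∀ v, D ≤ v.degree → MvPowerSeries.coeff v F = 0) : Bounded ρ (ρ ^ D) F := by
  intro v
  by_cases hv : D ≤ v.degree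
  · rw [h v hv]
    simp only [ZeroMemClass.coe_zero, norm_zero, zero_mul]
    positivity
  · calc _ ≤ 1 * ρ ^ v.degree :=
        mul_le_mul_of_nonneg_right (norm_coe_le_one _) (by positivity)
      _ = ρ ^ v.degree := one_mul _
      _ ≤ ρ ^ D := pow_le_pow_right₀ hρ (by omega)

variable (p K n) in
/-- The inclusion of the polynomial ring `R[ξ_1, …, ξ_n]` in `T_n†`. -/
def Dagger.ofPoly : MvPolynomial (Fin n) (RInt K) →ₐ[RInt K] Dagger p K n :=
  (MvPolynomial.coeToMvPowerSeries.algHom (RInt K)).codRestrict (daggerSubalgebra p K n)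
    (fun P => mem_daggerSubalgebra.2 ((isOverconvergent_iff p _).2
      ⟨2, 2 ^ (P.totalDegree + 1), by norm_num, bounded_of_degree_lt (by norm_num) (fun v hv => by
        rw [MvPolynomial.coeToMvPowerSeries.algHom_apply, Algebra.algebraMap_self,
          MvPowerSeries.map_id, RingHom.id_apply, MvPolynomial.coeff_coe]
        apply MvPolynomial.coeff_eq_zero_of_totalDegree_lt
        rw [← Finsupp.degree_apply]
        omega)⟩))

theorem Dagger.coeff_ofPoly (P : MvPolynomial (Fin n) (RInt K)) (v : Fin n →₀ ℕ) :
    MvPowerSeries.coeff v (Dagger.ofPoly p K n P).1 = MvPolynomial.coeff v P := by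
  change MvPowerSeries.coeff v (MvPolynomial.coeToMvPowerSeries.algHom (RInt K) P) = _
  rw [MvPolynomial.coeToMvPowerSeries.algHom_apply, Algebra.algebraMap_self,
    MvPowerSeries.map_id, RingHom.id_apply, MvPolynomial.coeff_coe]

/-- Modulo `a`, an overconvergent series is a polynomial of controlled degree. -/
theorem Dagger.exists_eq_ofPoly_add {a : RInt K} (ha0 : a ≠ 0) {ρ C : ℝ}
    (hρ : 1 < ρ) {D : ℕ} (hD : C ≤ ‖(a : K)‖ * ρ ^ D) (x : Dagger p K n)
    (hx : Bounded ρ C x.1) :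
    ∃ (P : MvPolynomial (Fin n) (RInt K)) (y : Dagger p K n),
      (∀ v, D ≤ v.degree → P.coeff v = 0) ∧
      x = Dagger.ofPoly p K n P + algebraMap (RInt K) (Dagger p K n) a * y ∧
      Bounded ρ (C / ‖(a : K)‖) y.1 := by
  have hco : ∀ v, MvPowerSeries.coeff v (x - Dagger.ofPoly p K n
      (MvPowerSeries.truncTotal D x.1)).1 =
      if v.degree < D then 0 else MvPowerSeries.coeff v x.1 := by
    intro v
    change MvPowerSeries.coeff v (x.1 - (Dagger.ofPoly p K n _).1) = _
    rw [map_sub, Dagger.coeff_ofPoly, MvPowerSeries.coeff_truncTotal_eq_ite]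
    split_ifs <;> simp
  have hC := hx.nonneg
  have hb : Bounded ρ C (x - Dagger.ofPoly p K n (MvPowerSeries.truncTotal D x.1)).1 := by
    intro v
    rw [hco]
    split_ifs
    · simpa using hC
    · exact hx v
  obtain ⟨y, hy, hyb⟩ := Dagger.exists_eq_mul (x - Dagger.ofPoly p K n
      (MvPowerSeries.truncTotal D x.1)) a ha0 (fun v => by
    rw [hco]
    split_ifs with hv
    · simp
    · have h1 := hx v
      have h2 : ρ ^ D ≤ ρ ^ v.degree := pow_le_pow_right₀ hρ.le (by omega)
      have h3 : 0 < ρ ^ v.degree := by positivity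
      refine le_of_mul_le_mul_right (h1.trans (hD.trans ?_)) h3
      exact mul_le_mul_of_nonneg_left h2 (norm_nonneg _))
  refine ⟨MvPowerSeries.truncTotal D x.1, y,
    fun v hv => MvPowerSeries.coeff_truncTotal_eq_zero _ hv, ?_, hyb _ _ hb⟩
  rw [← hy]
  ring

end Polynomials

/-! ### Submodules of free modules over polynomial rings -/

section Polynomial

open MvPolynomial

theorem homogeneousComponent_mul_left {σ S : Type*} [CommSemiring S] {q P : MvPolynomial σ S}
    {a : ℕ} (hq : q.IsHomogeneous a) (e : ℕ) :
    homogeneousComponent e (q * P) = if a ≤ e then q * homogeneousComponent (e - a) P else 0 := by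
  have h1 : ∀ i, homogeneousComponent e (q * homogeneousComponent i P)
      = if e = a + i then q * homogeneousComponent i P else 0 := fun i =>
    homogeneousComponent_of_mem
      ((mem_homogeneousSubmodule _ _).2 (hq.mul (homogeneousComponent_isHomogeneous _ _)))
  conv_lhs => rw [← sum_homogeneousComponent P, Finset.mul_sum, map_sum,
    Finset.sum_congr rfl fun i _ => h1 i]
  split_ifs with h
  · rw [Finset.sum_eq_single (e - a) (fun i _ hi => if_neg (by omega)), if_pos (by omega)]
    intro h2
    rw [homogeneousComponent_eq_zero _ _ (by have := Finset.mem_range.not.1 h2; omega), mul_zero, ite_self]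
  · exact Finset.sum_eq_zero fun i _ => if_neg (by omega)

theorem homogeneousComponent_mul_right {σ S : Type*} [CommSemiring S] {q P : MvPolynomial σ S}
    {a : ℕ} (hq : q.IsHomogeneous a) (e : ℕ) :
    homogeneousComponent e (P * q) = if a ≤ e then homogeneousComponent (e - a) P * q else 0 := by
  rw [mul_comm, homogeneousComponent_mul_left hq]
  split_ifs
  · exact mul_comm _ _
  · rfl

theorem forall_homogeneousComponent_eq_zero_iff {σ S : Type*} [CommSemiring S]
    {P : MvPolynomial σ S} {D : ℕ} :
    (∀ v : σ →₀ ℕ, D ≤ v.degree → P.coeff v = 0) ↔ ∀ e, D ≤ e → homogeneousComponent e P = 0 := by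
  constructor
  · intro h e he
    ext v
    rw [coeff_homogeneousComponent]
    split_ifs with hv
    · rw [h v (hv ▸ he), coeff_zero]
    · rw [coeff_zero]
  · intro h v hv
    have := congrArg (coeff v) (h v.degree hv)
    rwa [coeff_homogeneousComponent, if_pos rfl, coeff_zero] at this

/-- A submodule of a finite free module over a polynomial ring with noetherian coefficients has
finitely many generators such that the elements of degree less than `D` are combinations whose
coefficients have degree less than `D`: lift generators of the module of leading forms. -/
theorem exists_generators_degree_lt {S : Type*} [CommRing S] [IsNoetherianRing S] {n m : ℕ}
    (N : Submodule (MvPolynomial (Fin n) S) (Fin m → MvPolynomial (Fin n) S)) :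
    ∃ (L : ℕ) (g : Fin L → Fin m → MvPolynomial (Fin n) S), (∀ l, g l ∈ N) ∧
      ∀ D : ℕ, ∀ P ∈ N, (∀ i (v : Fin n →₀ ℕ), D ≤ v.degree → (P i).coeff v = 0) →
        ∃ q : Fin L → MvPolynomial (Fin n) S,
          (∀ l (v : Fin n →₀ ℕ), D ≤ v.degree → (q l).coeff v = 0) ∧ P = ∑ l, q l • g l := by
  classical
  let lead : ℕ → (Fin m → MvPolynomial (Fin n) S) → Fin m → MvPolynomial (Fin n) S :=
    fun d P i => homogeneousComponent d (P i)
  -- The leading forms of the elements of `N`; the form in degree `d` may vanish.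
  let A : Set (Fin m → MvPolynomial (Fin n) S) :=
    {x | ∃ d, ∃ P ∈ N, (∀ i e, d + 1 ≤ e → homogeneousComponent e (P i) = 0) ∧ lead d P = x}
  obtain ⟨T, hTA, hT⟩ := Submodule.fg_span_iff_fg_span_finset_subset A |>.1
    (IsNoetherian.noetherian (Submodule.span (MvPolynomial (Fin n) S) A))
  have hT' : ∀ t : T, ∃ d, ∃ P ∈ N,
      (∀ i e, d + 1 ≤ e → homogeneousComponent e (P i) = 0) ∧ lead d P = t := fun t => hTA t.2
  choose d g hgN hgd hgt using hT'
  have main : ∀ D : ℕ, ∀ P ∈ N, (∀ i e, D ≤ e → homogeneousComponent e (P i) = 0) →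
      ∃ q : T → MvPolynomial (Fin n) S,
        (∀ t e, D ≤ e → homogeneousComponent e (q t) = 0) ∧ P = ∑ t, q t • g t := by
    intro D
    induction D with
    | zero =>
      intro P _ hP
      refine ⟨0, fun t e _ => map_zero _, ?_⟩
      have : P = 0 := by
        funext i
        rw [← sum_homogeneousComponent (P i)]
        exact Finset.sum_eq_zero fun e _ => hP i e (Nat.zero_le _)
      simp [this]
    | succ D ih =>
      intro P hPN hP
      have hmem : lead D P ∈ Submodule.span (MvPolynomial (Fin n) S)
          (T : Set (Fin m → MvPolynomial (Fin n) S)) := by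
        rw [← hT]
        exact Submodule.subset_span ⟨D, P, hPN, hP, rfl⟩
      obtain ⟨c, hc⟩ := Submodule.mem_span_finset'.1 hmem
      -- Only the components of the right degree are kept, so that no degree exceeds `D`.
      let q : T → MvPolynomial (Fin n) S := fun t =>
        if d t ≤ D then homogeneousComponent (D - d t) (c t) else 0
      have hq : ∀ t e i, D ≤ e → homogeneousComponent e (q t * g t i)
          = if e = D then q t * (t : Fin m → MvPolynomial (Fin n) S) i else 0 := by
        intro t e i he
        simp only [q]
        split_ifs with h1 h2 h2
        · rw [homogeneousComponent_mul_left (homogeneousComponent_isHomogeneous _ _),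
            if_pos (by omega), h2, Nat.sub_sub_self h1, ← hgt t]
        · rw [homogeneousComponent_mul_left (homogeneousComponent_isHomogeneous _ _),
            if_pos (by omega), hgd t i _ (by omega), mul_zero]
        · simp
        · simp
      have htop : ∀ i, homogeneousComponent D (P i)
          = ∑ t, q t * (t : Fin m → MvPolynomial (Fin n) S) i := by
        intro i
        have h1 : homogeneousComponent D (P i)
            = homogeneousComponent D (∑ t, c t * (t : Fin m → MvPolynomial (Fin n) S) i) := by
          have h2 := congrFun hc i
          simp only [Finset.sum_apply, Pi.smul_apply, smul_eq_mul] at h2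
          rw [h2]
          exact (homogeneousComponent_eq_self (homogeneousComponent_isHomogeneous _ _)).symm
        rw [h1, map_sum]
        refine Finset.sum_congr rfl fun t _ => ?_
        have h3 : ((t : Fin m → MvPolynomial (Fin n) S) i).IsHomogeneous (d t) := by
          rw [← hgt t]
          exact homogeneousComponent_isHomogeneous _ _
        rw [homogeneousComponent_mul_right h3]
        simp only [q, ite_mul, zero_mul]
      obtain ⟨q', hq'1, hq'2⟩ := ih (P - ∑ t, q t • g t)
        (N.sub_mem hPN (N.sum_mem fun t _ => N.smul_mem _ (hgN t))) (by
          intro i e he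
          simp only [Pi.sub_apply, Finset.sum_apply, Pi.smul_apply, smul_eq_mul, map_sub, map_sum]
          rw [Finset.sum_congr rfl fun t _ => hq t e i he]
          by_cases h : e = D
          · subst h
            simp only [if_true]
            rw [htop, sub_self]
          · rw [hP i e (by omega)]
            simp [h])
      refine ⟨fun t => q t + q' t, fun t e he => ?_, ?_⟩
      · rw [map_add, hq'1 t e (by omega), add_zero]
        simp only [q]
        split_ifs with h
        · rw [homogeneousComponent_of_mem (homogeneousComponent_mem _ _), if_neg (by omega)]
        · exact map_zero _
      · simp only [add_smul, Finset.sum_add_distrib]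
        rw [← hq'2]
        abel
  refine ⟨Fintype.card T, fun l => g ((Fintype.equivFin T).symm l), fun l => hgN _,
    fun D P hP hD => ?_⟩
  obtain ⟨q, hq1, hq2⟩ := main D P hP
    (fun i => forall_homogeneousComponent_eq_zero_iff.1 (hD i))
  refine ⟨fun l => q ((Fintype.equivFin T).symm l),
    fun l => forall_homogeneousComponent_eq_zero_iff.2 (hq1 _), ?_⟩
  rw [hq2]
  exact ((Fintype.equivFin T).symm.sum_comp fun t => q t • g t).symm

end Polynomial

/-! ### Division by a submodule with control of the radius -/

section Division

variable {p : ℕ} [Fact p.Prime] {K : Type*} [NormedField K] [IsUltrametricDist K] {n m : ℕ}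

/-- A shortcut: through the subalgebra structure of `T_n†` the search for this instance and the
following ones is slow. -/
instance Dagger.moduleTuple : Module (Dagger p K n) (Fin m → Dagger p K n) :=
  Pi.Function.module _ _ _

instance Dagger.smulTuple : SMul (Dagger p K n) (Fin m → Dagger p K n) :=
  (Dagger.moduleTuple (p := p) (K := K) (n := n) (m := m)).toSMul

instance Dagger.distribMulActionTuple :
    DistribMulAction (Dagger p K n) (Fin m → Dagger p K n) :=
  (Dagger.moduleTuple (p := p) (K := K) (n := n) (m := m)).toDistribMulAction

instance Dagger.mulActionTuple : MulAction (Dagger p K n) (Fin m → Dagger p K n) :=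
  (Dagger.distribMulActionTuple (p := p) (K := K) (n := n) (m := m)).toMulAction

instance Dagger.semigroupActionTuple :
    SemigroupAction (Dagger p K n) (Fin m → Dagger p K n) :=
  (Dagger.mulActionTuple (p := p) (K := K) (n := n) (m := m)).toSemigroupAction

instance Dagger.smulCommClassTuple :
    SMulCommClass (Dagger p K n) (Dagger p K n) (Fin m → Dagger p K n) :=
  ⟨fun b c x => by rw [← mul_smul, mul_comm, mul_smul]⟩

/-- The polynomial vectors `P` such that `a^s (P + a t)` lies in `N` for some `t`: the preimage in
the polynomial module of the `s`-th module of residues `{x mod a : a^s x ∈ N}`. -/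
def residueSubmodule (a : RInt K) (N : Submodule (Dagger p K n) (Fin m → Dagger p K n)) (s : ℕ) :
    Submodule (MvPolynomial (Fin n) (RInt K)) (Fin m → MvPolynomial (Fin n) (RInt K)) where
  carrier := {P | ∃ t : Fin m → Dagger p K n, algebraMap (RInt K) (Dagger p K n) a ^ s •
    ((fun i => Dagger.ofPoly p K n (P i)) + algebraMap (RInt K) (Dagger p K n) a • t) ∈ N}
  add_mem' := by
    rintro P Q ⟨t, ht⟩ ⟨u, hu⟩
    refine ⟨t + u, ?_⟩
    convert N.add_mem ht hu using 1
    funext i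
    simp only [Pi.smul_apply, Pi.add_apply, map_add, smul_eq_mul]
    ring
  zero_mem' := by
    refine ⟨0, ?_⟩
    convert N.zero_mem using 1
    funext i
    simp
  smul_mem' := by
    rintro Q P ⟨t, ht⟩
    refine ⟨Dagger.ofPoly p K n Q • t, ?_⟩
    convert N.smul_mem (Dagger.ofPoly p K n Q) ht using 1
    funext i
    simp only [Pi.smul_apply, Pi.add_apply, map_mul, smul_eq_mul]
    ring

theorem residueSubmodule_mono (a : RInt K)
    (N : Submodule (Dagger p K n) (Fin m → Dagger p K n)) : Monotone (residueSubmodule a N) := by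
  refine monotone_nat_of_le_succ fun s => ?_
  rintro P ⟨t, ht⟩
  refine ⟨t, ?_⟩
  rw [pow_succ', mul_smul]
  exact N.smul_mem _ ht

/-- One step of division by a submodule `N` of a finite free `T_n†`-module. If
`a^s z ∈ N + (a^(s+1))` then `a^s z ≡ a^(s+1) z'` modulo `N`, where the bound of `z'` exceeds the
bound of `z` by a factor that does not depend on `s`. From some exponent `j₀` on, the element of `N` that is subtracted is a
combination of fixed elements, with coefficients bounded likewise. -/
theorem exists_division_step [IsNoetherianRing (RInt K)] {a : RInt K} (ha0 : a ≠ 0)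
    (ha : ‖(a : K)‖ < 1) (N : Submodule (Dagger p K n) (Fin m → Dagger p K n)) :
    ∃ (j₀ L : ℕ) (h : Fin L → Fin m → Dagger p K n),
      (∀ l, algebraMap (RInt K) (Dagger p K n) a ^ j₀ • h l ∈ N) ∧
      ∃ ρ₀ : ℝ, 1 < ρ₀ ∧ ∀ ρ, 1 < ρ → ρ ≤ ρ₀ → ∃ B : ℝ, 1 ≤ B ∧
        ∀ (s : ℕ) (C : ℝ) (z : Fin m → Dagger p K n), 1 ≤ C → (∀ i, Bounded ρ C (z i).1) →
          (∃ t : Fin m → Dagger p K n, algebraMap (RInt K) (Dagger p K n) a ^ s • z -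
            algebraMap (RInt K) (Dagger p K n) a ^ (s + 1) • t ∈ N) →
          ∃ z' : Fin m → Dagger p K n, (∀ i, Bounded ρ (C * B) (z' i).1) ∧
            algebraMap (RInt K) (Dagger p K n) a ^ s • z -
              algebraMap (RInt K) (Dagger p K n) a ^ (s + 1) • z' ∈ N ∧
            (j₀ ≤ s → ∃ q : Fin L → Dagger p K n, (∀ l, Bounded ρ (C * B) (q l).1) ∧
              z - algebraMap (RInt K) (Dagger p K n) a • z' = ∑ l, q l • h l) := by
  have ha' : 0 < ‖(a : K)‖ := norm_pos_iff.2 (by simpa using ha0)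
  set w := algebraMap (RInt K) (Dagger p K n) a with hw
  have hnoeth : IsNoetherian (MvPolynomial (Fin n) (RInt K))
      (Fin m → MvPolynomial (Fin n) (RInt K)) := inferInstance
  obtain ⟨j₀, hj₀⟩ := monotone_stabilizes_iff_noetherian.2 hnoeth
    ⟨residueSubmodule a N, residueSubmodule_mono a N⟩
  -- As the chain stabilizes, finitely many families of generators, hence a single radius `ρ₀`,
  -- serve all `s`.
  have hst : ∀ s, residueSubmodule a N s = residueSubmodule a N (min s j₀) := by
    intro s
    rcases le_total s j₀ with h | h
    · rw [min_eq_left h]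
    · rw [min_eq_right h]
      exact (hj₀ s h).symm
  choose L g hgN hg using fun s => exists_generators_degree_lt (residueSubmodule a N s)
  choose t ht using fun s l => show ∃ t : Fin m → Dagger p K n, w ^ s •
    ((fun i => Dagger.ofPoly p K n (g s l i)) + w • t) ∈ N from hgN s l
  obtain ⟨ρ₀, hρ₀, hb⟩ := exists_common_bound (p := p)
    (a := fun x : (Σ s : Fin (j₀ + 1), Fin (L s)) × Fin m => (t x.1.1 x.1.2 x.2).1)
    (fun x => (t x.1.1 x.1.2 x.2).2) (B := 2) (by norm_num)
  have hb' : ∀ s, s ≤ j₀ → ∀ l i, Bounded ρ₀ 2 (t s l i).1 := fun s hs l i =>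
    hb ⟨⟨⟨s, by omega⟩, l⟩, i⟩
  refine ⟨j₀, L j₀, fun l => (fun i => Dagger.ofPoly p K n (g j₀ l i)) + w • t j₀ l,
    fun l => ht j₀ l, ρ₀, hρ₀, fun ρ hρ hρ' => ⟨2 * ρ / ‖(a : K)‖, ?_, ?_⟩⟩
  · rw [one_le_div ha']
    linarith
  intro s C z hC hz ⟨u, hu⟩
  have hρ0 : 0 < ρ := by linarith
  -- The least `D` for which `z` is modulo `a` a polynomial of degree at most `D`: then `ρ^D`, which
  -- bounds polynomials of this degree, is comparable to `C`.
  obtain ⟨D, hD1, hD2⟩ := exists_nat_pow_near (x := C / ‖(a : K)‖)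
    ((one_le_div ha').2 (ha.le.trans hC)) hρ
  have hD : C ≤ ‖(a : K)‖ * ρ ^ (D + 1) := by
    rw [div_lt_iff₀ ha'] at hD2
    linarith
  have hD' : ρ ^ (D + 1) ≤ C * (ρ / ‖(a : K)‖) := by
    rw [pow_succ]
    calc _ ≤ C / ‖(a : K)‖ * ρ := mul_le_mul_of_nonneg_right hD1 hρ0.le
      _ = _ := by ring
  choose P y hP hzy hy using fun i =>
    Dagger.exists_eq_ofPoly_add (p := p) ha0 hρ hD (z i) (hz i)
  set s' := min s j₀ with hs'
  have hs'j : s' ≤ j₀ := min_le_right _ _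
  have hPN : P ∈ residueSubmodule a N s' := by
    rw [← hst]
    refine ⟨y - u, ?_⟩
    convert hu using 1
    funext i
    simp only [Pi.smul_apply, Pi.add_apply, Pi.sub_apply, smul_eq_mul, hzy i]
    ring
  obtain ⟨q, hq1, hq2⟩ := hg s' (D + 1) P hPN hP
  have hqb : ∀ l, Bounded ρ (ρ ^ (D + 1)) (Dagger.ofPoly p K n (q l)).1 := fun l =>
    bounded_of_degree_lt hρ.le (fun v hv => by rw [Dagger.coeff_ofPoly]; exact hq1 l v hv)
  have hCB : 0 ≤ C * (2 * ρ / ‖(a : K)‖) := by positivity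
  have hkey : z - w • (y - ∑ l, Dagger.ofPoly p K n (q l) • t s' l) =
      ∑ l, Dagger.ofPoly p K n (q l) •
        ((fun i => Dagger.ofPoly p K n (g s' l i)) + w • t s' l) := by
    funext i
    have h1 : P i = ∑ l, q l * g s' l i := by
      have := congrFun hq2 i
      simpa only [Finset.sum_apply, Pi.smul_apply, smul_eq_mul] using this
    simp only [Pi.smul_apply, Pi.add_apply, Pi.sub_apply, Finset.sum_apply, smul_eq_mul, hzy i,
      h1, map_sum, map_mul, mul_add, Finset.sum_add_distrib, mul_sub, Finset.mul_sum]
    rw [Finset.sum_congr rfl fun l _ => mul_left_comm w (Dagger.ofPoly p K n (q l)) (t s' l i)]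
    ring
  refine ⟨y - ∑ l, Dagger.ofPoly p K n (q l) • t s' l, fun i => ?_, ?_, fun hjs => ?_⟩
  · refine Bounded.sub hρ0.le ((hy i).mono hρ0.le le_rfl ?_) ?_
    · rw [div_eq_mul_inv]
      refine mul_le_mul_of_nonneg_left ?_ (by linarith)
      rw [div_eq_mul_inv]
      exact le_mul_of_one_le_left (by positivity) (by linarith)
    · rw [Finset.sum_apply]
      refine bounded_sum _ hρ0.le hCB fun l _ => ?_
      refine ((hqb l).mul hρ0.le ((hb' s' hs'j l i).mono hρ0.le hρ' le_rfl)).mono hρ0.le le_rfl ?_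
      calc _ ≤ C * (ρ / ‖(a : K)‖) * 2 := mul_le_mul_of_nonneg_right hD' (by norm_num)
        _ = _ := by ring
  · have hsub : w ^ s • z - w ^ (s + 1) • (y - ∑ l, Dagger.ofPoly p K n (q l) • t s' l) =
        w ^ s • (z - w • (y - ∑ l, Dagger.ofPoly p K n (q l) • t s' l)) := by
      rw [smul_sub (w ^ s), pow_succ, mul_smul]
    rw [hsub, hkey, Finset.smul_sum]
    refine N.sum_mem fun l _ => ?_
    rw [smul_comm, ← Nat.sub_add_cancel (min_le_left s j₀ : s' ≤ s), pow_add, mul_smul]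
    exact N.smul_mem _ (N.smul_mem _ (ht s' l))
  · have hj : s' = j₀ := min_eq_right hjs
    clear_value s'
    subst hj
    refine ⟨fun l => Dagger.ofPoly p K n (q l), fun l => (hqb l).mono hρ0.le le_rfl ?_, hkey⟩
    refine hD'.trans (mul_le_mul_of_nonneg_left ?_ (by linarith))
    exact div_le_div_of_nonneg_right (by linarith) ha'.le

/-- Elements of `N + (a^J)` with given coefficient bounds are congruent modulo `N` to multiples
`a^J z`, where the bound of `z` grows at most geometrically in `J`. -/
theorem exists_bounded_division [IsNoetherianRing (RInt K)] {a : RInt K} (ha0 : a ≠ 0)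
    (ha : ‖(a : K)‖ < 1) (N : Submodule (Dagger p K n) (Fin m → Dagger p K n)) :
    ∃ ρ₀ : ℝ, 1 < ρ₀ ∧ ∀ ρ, 1 < ρ → ρ ≤ ρ₀ → ∃ B : ℝ, 1 ≤ B ∧
      ∀ (J : ℕ) (C : ℝ) (z : Fin m → Dagger p K n), 1 ≤ C → (∀ i, Bounded ρ C (z i).1) →
        (∃ t : Fin m → Dagger p K n, z - algebraMap (RInt K) (Dagger p K n) a ^ J • t ∈ N) →
        ∃ z' : Fin m → Dagger p K n, (∀ i, Bounded ρ (C * B ^ J) (z' i).1) ∧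
          z - algebraMap (RInt K) (Dagger p K n) a ^ J • z' ∈ N := by
  obtain ⟨j₀, L, h, -, ρ₀, hρ₀, H⟩ := exists_division_step ha0 ha N
  refine ⟨ρ₀, hρ₀, fun ρ hρ hρ' => ?_⟩
  obtain ⟨B, hB, H⟩ := H ρ hρ hρ'
  refine ⟨B, hB, fun J => ?_⟩
  set w := algebraMap (RInt K) (Dagger p K n) a with hw
  induction J with
  | zero =>
    intro C z hC hz _
    exact ⟨z, by simpa using hz, by simp⟩
  | succ J ih =>
    intro C z hC hz ⟨t, ht⟩
    obtain ⟨z₁, hz₁, hN₁⟩ := ih C z hC hz ⟨w • t, by rwa [← mul_smul, ← pow_succ]⟩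
    obtain ⟨z₂, hz₂, hN₂, -⟩ := H J (C * B ^ J) z₁ (one_le_mul_of_one_le_of_one_le hC
      (one_le_pow₀ hB)) hz₁ ⟨t, by
        have := N.sub_mem ht hN₁
        rwa [sub_sub_sub_cancel_left] at this⟩
    refine ⟨z₂, by simpa only [pow_succ, mul_assoc] using hz₂, ?_⟩
    have := N.add_mem hN₁ hN₂
    rwa [sub_add_sub_cancel] at this

/-- Every submodule of a finite free `T_n†`-module is closed for the `a`-adic topology: the
quotients produced by repeated division form an overconvergent series. -/
theorem mem_of_forall_exists_sub_mem [CompleteSpace K] [IsNoetherianRing (RInt K)] {a : RInt K}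
    (ha0 : a ≠ 0) (ha : ‖(a : K)‖ < 1) (N : Submodule (Dagger p K n) (Fin m → Dagger p K n))
    {z : Fin m → Dagger p K n}
    (hz : ∀ J : ℕ, ∃ t : Fin m → Dagger p K n,
      z - algebraMap (RInt K) (Dagger p K n) a ^ J • t ∈ N) : z ∈ N := by
  obtain ⟨j₀, L, h, hN, ρ₀, hρ₀, H⟩ := exists_division_step ha0 ha N
  obtain ⟨ρ₁, hρ₁, H'⟩ := exists_bounded_division ha0 ha N
  obtain ⟨ρ₂, hρ₂, hzb⟩ := exists_common_bound (p := p) (a := fun i => (z i).1)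
    (fun i => (z i).2) (B := 2) (by norm_num)
  obtain ⟨ρ, hρ, hρr⟩ : ∃ ρ, 1 < ρ ∧ ρ ≤ ρ₀ ∧ ρ ≤ ρ₁ ∧ ρ ≤ ρ₂ :=
    ⟨min ρ₀ (min ρ₁ ρ₂), lt_min hρ₀ (lt_min hρ₁ hρ₂), min_le_left _ _,
      (min_le_right _ _).trans (min_le_left _ _), (min_le_right _ _).trans (min_le_right _ _)⟩
  have hρ0 : 0 ≤ ρ := by linarith
  obtain ⟨B, hB, H⟩ := H ρ hρ hρr.1
  obtain ⟨B', hB', H'⟩ := H' ρ hρ hρr.2.1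
  obtain ⟨y₀, hy₀, hzy⟩ := H' j₀ 2 z (by norm_num)
    (fun i => (hzb i).mono hρ0 hρr.2.2 le_rfl) (hz j₀)
  set w := algebraMap (RInt K) (Dagger p K n) a with hw
  set C := 2 * B' ^ j₀ with hC
  have hC1 : 1 ≤ C := one_le_mul_of_one_le_of_one_le (by norm_num) (one_le_pow₀ hB')
  -- Division can be repeated on the quotients: `z - a^j₀ y₀` lies in `N`, and
  -- `y_j - a y_{j+1}` is a combination of the fixed elements `h l`.
  let Inv : ℕ → (Fin m → Dagger p K n) → Prop := fun j y =>
    (∀ i, Bounded ρ (C * B ^ j) (y i).1) ∧ z - w ^ (j₀ + j) • y ∈ N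
  have hstep : ∀ j (y : {y // Inv j y}), ∃ y' : {y // Inv (j + 1) y}, ∃ q : Fin L → Dagger p K n,
      (∀ l, Bounded ρ (C * B ^ (j + 1)) (q l).1) ∧ y.1 - w • y'.1 = ∑ l, q l • h l := by
    rintro j ⟨y, hy1, hy2⟩
    obtain ⟨t, ht⟩ := hz (j₀ + j + 1)
    obtain ⟨y', h1, h2, h3⟩ := H (j₀ + j) (C * B ^ j) y
      (one_le_mul_of_one_le_of_one_le hC1 (one_le_pow₀ hB)) hy1 ⟨t, by
        have := N.sub_mem ht hy2
        rwa [sub_sub_sub_cancel_left] at this⟩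
    obtain ⟨q, hq1, hq2⟩ := h3 (Nat.le_add_right _ _)
    refine ⟨⟨y', ?_, ?_⟩, q, ?_, hq2⟩
    · simpa only [pow_succ, mul_assoc] using h1
    · have := N.add_mem hy2 h2
      rwa [sub_add_sub_cancel] at this
    · simpa only [pow_succ, mul_assoc] using hq1
  choose next q hq hnext using hstep
  let Y : (j : ℕ) → {y // Inv j y} := fun j =>
    Nat.rec ⟨y₀, by simpa using hy₀, by simpa using hzy⟩ next j
  have hY : ∀ j, (Y j).1 - w • (Y (j + 1)).1 = ∑ l, q j (Y j) l • h l := fun j => hnext j (Y j)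
  have htel : ∀ J, y₀ = ∑ j ∈ Finset.range J, w ^ j • ∑ l, q j (Y j) l • h l + w ^ J • (Y J).1 := by
    intro J
    induction J with
    | zero => simp [Y]
    | succ J ih =>
      rw [Finset.sum_range_succ, ← hY J, smul_sub, ← mul_smul, ← pow_succ]
      rw [add_assoc, sub_add_cancel]
      exact ih
  choose S hS using fun l => Dagger.exists_series_sum (p := p) (C := C * B) ha0 ha hρ hB
    (fun j => q j (Y j) l) (fun j => by
      have := hq j (Y j) l
      rwa [pow_succ', ← mul_assoc] at this)
  have hy : y₀ = ∑ l, S l • h l := by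
    rw [← sub_eq_zero]
    funext i
    refine Dagger.eq_zero_of_forall_dvd ha fun J => ?_
    choose T hT using fun l => hS l J
    refine ⟨((Y J).1 - ∑ l, T l • h l) i, ?_⟩
    have : y₀ - ∑ l, S l • h l = w ^ J • ((Y J).1 - ∑ l, T l • h l) := by
      rw [htel J, Finset.sum_congr rfl fun l _ => congrArg (· • h l) (hT l)]
      simp only [add_smul, Finset.sum_add_distrib, Finset.sum_smul, Finset.smul_sum, smul_sub,
        mul_smul]
      rw [Finset.sum_comm]
      abel
    rw [this]
    rfl
  have hw0 : w ^ j₀ • y₀ ∈ N := by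
    rw [hy, Finset.smul_sum]
    refine N.sum_mem fun l _ => ?_
    rw [smul_comm]
    exact N.smul_mem _ (hN l)
  simpa using N.add_mem hzy hw0

end Division

/-! ### Expansion along the last variable -/

section LastVariable

variable {p : ℕ} [Fact p.Prime] {K : Type*} [NormedField K] [IsUltrametricDist K] {n : ℕ}

/-- The exponent of `ξ^x ξ_{n+1}^k`. -/
def snocIndex (x : Fin n →₀ ℕ) (k : ℕ) : Fin (n + 1) →₀ ℕ :=
  Finsupp.embDomain finSuccEquivLast.symm.toEmbedding (x.optionElim k)

theorem exists_eq_snocIndex (v : Fin (n + 1) →₀ ℕ) : ∃ x k, v = snocIndex x k := by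
  refine ⟨(Finsupp.embDomain finSuccEquivLast.toEmbedding v).some,
    (Finsupp.embDomain finSuccEquivLast.toEmbedding v) none, ?_⟩
  rw [snocIndex, Finsupp.optionElim_some]
  simp only [Finsupp.embDomain_eq_mapDomain, ← Finsupp.mapDomain_comp]
  simp

theorem degree_snocIndex (x : Fin n →₀ ℕ) (k : ℕ) : (snocIndex x k).degree = x.degree + k := by
  have h : ∀ i, snocIndex x k i = (x.optionElim k) (finSuccEquivLast i) := by
    intro i
    have := Finsupp.embDomain_apply_self finSuccEquivLast.symm.toEmbedding (x.optionElim k)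
      (finSuccEquivLast i)
    simpa [snocIndex] using this
  rw [Finsupp.degree_eq_sum, Finsupp.degree_eq_sum, Fin.sum_univ_castSucc]
  simp [h]

variable (K n) in
/-- `R[[ξ_1, …, ξ_{n+1}]]` as a power series ring in the last variable. -/
def lastVarEquiv : MvPowerSeries (Fin (n + 1)) (RInt K) ≃ₐ[RInt K]
    PowerSeries (MvPowerSeries (Fin n) (RInt K)) :=
  (MvPowerSeries.renameEquiv (RInt K) finSuccEquivLast).trans
    (MvPowerSeries.optionEquivLeft (Fin n) (RInt K))

theorem coeff_coeff_lastVarEquiv (F : MvPowerSeries (Fin (n + 1)) (RInt K)) (x : Fin n →₀ ℕ)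
    (k : ℕ) : MvPowerSeries.coeff x (PowerSeries.coeff k (lastVarEquiv K n F)) =
      MvPowerSeries.coeff (snocIndex x k) F := by
  have h : F = MvPowerSeries.rename finSuccEquivLast.symm.toEmbedding
      (MvPowerSeries.rename (R := RInt K) finSuccEquivLast F) := by
    simp
  conv_rhs => rw [h, snocIndex, MvPowerSeries.coeff_embDomain_rename]
  exact MvPowerSeries.coeff_coeff_optionEquivLeft
    (MvPowerSeries.rename (R := RInt K) finSuccEquivLast F) k x

theorem lastVarEquiv_X : lastVarEquiv K n (MvPowerSeries.X (Fin.last n)) = PowerSeries.X := by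
  simp [lastVarEquiv]

theorem Dagger.lastVarEquiv_incl (a : Dagger p K n) :
    lastVarEquiv K n (Dagger.incl p K n a).1 = PowerSeries.C a.1 := by
  classical
  have h1 : (Dagger.incl p K n a).1 = MvPowerSeries.rename (R := RInt K) Fin.castSucc a.1 := by
    rw [MvPowerSeries.rename_eq_subst]
    exact Dagger.coe_subst _ (fun _ => MvPowerSeries.constantCoeff_X _) a
  rw [h1]
  change MvPowerSeries.optionEquivLeft (Fin n) (RInt K)
    (MvPowerSeries.rename (R := RInt K) finSuccEquivLast (MvPowerSeries.rename (R := RInt K) Fin.castSucc a.1)) = _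
  rw [MvPowerSeries.rename_rename]
  have h2 : (finSuccEquivLast ∘ Fin.castSucc : Fin n → Option (Fin n))
      = Function.Embedding.some := by
    funext i
    simp
  have h3 : MvPowerSeries.rename (finSuccEquivLast ∘ Fin.castSucc : Fin n → Option (Fin n)) a.1 =
      MvPowerSeries.rename (Function.Embedding.some : Fin n ↪ Option (Fin n)) a.1 := by
    simp only [h2]
  rw [h3]
  refine PowerSeries.ext fun k => MvPowerSeries.ext fun x => ?_
  rw [MvPowerSeries.coeff_coeff_optionEquivLeft, PowerSeries.coeff_C]
  split_ifs with hk
  · subst hk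
    suffices h4 : Finsupp.optionElim 0 x =
        Finsupp.embDomain (Function.Embedding.some : Fin n ↪ Option (Fin n)) x by
      rw [h4, MvPowerSeries.coeff_embDomain_rename]
    ext i
    cases i with
    | none =>
      rw [Finsupp.optionElim_apply_none, Finsupp.embDomain_of_notMem_range]
      simp
    | some i =>
      rw [Finsupp.optionElim_apply_some]
      exact (Finsupp.embDomain_apply_self (Function.Embedding.some : Fin n ↪ Option (Fin n))
        x i).symm
  · rw [map_zero]
    apply MvPowerSeries.coeff_rename_eq_zero
    rintro ⟨y, hy⟩
    apply hk
    have := DFunLike.congr_fun hy none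
    rw [Finsupp.optionElim_apply_none, Finsupp.mapDomain_of_notMem_range] at this
    · exact this.symm
    · simp

theorem bounded_iff_snocIndex {ρ C : ℝ} (F : MvPowerSeries (Fin (n + 1)) (RInt K)) :
    Bounded ρ C F ↔ ∀ x k, ‖((MvPowerSeries.coeff x (PowerSeries.coeff k (lastVarEquiv K n F)) :
      RInt K) : K)‖ * ρ ^ (x.degree + k) ≤ C := by
  constructor
  · intro h x k
    rw [coeff_coeff_lastVarEquiv, ← degree_snocIndex]
    exact h _
  · intro h v
    obtain ⟨x, k, rfl⟩ := exists_eq_snocIndex v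
    rw [← coeff_coeff_lastVarEquiv, degree_snocIndex]
    exact h x k

theorem Bounded.coeff_lastVarEquiv {ρ C : ℝ} (hρ : 1 ≤ ρ)
    {F : MvPowerSeries (Fin (n + 1)) (RInt K)} (hF : Bounded ρ C F) (k : ℕ) :
    Bounded ρ C (PowerSeries.coeff k (lastVarEquiv K n F)) := by
  intro x
  refine le_trans ?_ ((bounded_iff_snocIndex F).1 hF x k)
  exact mul_le_mul_of_nonneg_left (pow_le_pow_right₀ hρ (Nat.le_add_right _ _)) (norm_nonneg _)

theorem Bounded.incl {ρ C : ℝ} {a : Dagger p K n} (ha : Bounded ρ C a.1) :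
    Bounded ρ C (algebraMap (Dagger p K n) (Dagger p K (n + 1)) a).1 := by
  rw [bounded_iff_snocIndex]
  intro x k
  change ‖((MvPowerSeries.coeff x (PowerSeries.coeff k
    (lastVarEquiv K n (Dagger.incl p K n a).1)) : RInt K) : K)‖ * ρ ^ (x.degree + k) ≤ C
  rw [Dagger.lastVarEquiv_incl, PowerSeries.coeff_C]
  split_ifs with hk
  · subst hk
    exact ha x
  · simpa using ha.nonneg

variable (p K n) in
/-- The coefficient of `ξ_{n+1}^k`, as a `T_n†`-linear map `T_{n+1}† → T_n†`. -/
def Dagger.lastCoeff (k : ℕ) : Dagger p K (n + 1) →ₗ[Dagger p K n] Dagger p K n where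
  toFun y := ⟨PowerSeries.coeff k (lastVarEquiv K n y.1), by
    obtain ⟨ρ, C, hρ, h⟩ := (isOverconvergent_iff p _).1 y.2
    exact (isOverconvergent_iff p _).2 ⟨ρ, C, hρ, h.coeff_lastVarEquiv hρ.le k⟩⟩
  map_add' x y := by
    apply Subtype.ext
    change PowerSeries.coeff k (lastVarEquiv K n (x.1 + y.1)) = _
    rw [map_add, map_add]
    rfl
  map_smul' a y := by
    apply Subtype.ext
    change PowerSeries.coeff k (lastVarEquiv K n ((Dagger.incl p K n a).1 * y.1)) = a.1 * _
    rw [map_mul, Dagger.lastVarEquiv_incl, PowerSeries.coeff_C_mul]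

theorem Dagger.coe_lastCoeff (k : ℕ) (y : Dagger p K (n + 1)) :
    (Dagger.lastCoeff p K n k y).1 = PowerSeries.coeff k (lastVarEquiv K n y.1) := rfl

theorem Dagger.lastCoeff_algebraMap_mul (k : ℕ) (a : Dagger p K n) (y : Dagger p K (n + 1)) :
    Dagger.lastCoeff p K n k (algebraMap (Dagger p K n) (Dagger p K (n + 1)) a * y) =
      a * Dagger.lastCoeff p K n k y := by
  rw [← Algebra.smul_def, map_smul, smul_eq_mul]

theorem Dagger.lastCoeff_X_mul (k : ℕ) (y : Dagger p K (n + 1)) :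
    Dagger.lastCoeff p K n (k + 1) (Dagger.X (Fin.last n) * y) = Dagger.lastCoeff p K n k y := by
  apply Subtype.ext
  change PowerSeries.coeff (k + 1) (lastVarEquiv K n (MvPowerSeries.X (Fin.last n) * y.1)) = _
  rw [map_mul, lastVarEquiv_X, PowerSeries.coeff_succ_X_mul]
  rfl

theorem Dagger.lastCoeff_zero_X_mul (y : Dagger p K (n + 1)) :
    Dagger.lastCoeff p K n 0 (Dagger.X (Fin.last n) * y) = 0 := by
  apply Subtype.ext
  change PowerSeries.coeff 0 (lastVarEquiv K n (MvPowerSeries.X (Fin.last n) * y.1)) = _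
  rw [map_mul, lastVarEquiv_X, PowerSeries.coeff_zero_X_mul]
  rfl

theorem Dagger.lastCoeff_algebraMap_mul_X_pow (k j : ℕ) (a : Dagger p K n) :
    Dagger.lastCoeff p K n k (algebraMap (Dagger p K n) (Dagger p K (n + 1)) a *
      Dagger.X (Fin.last n) ^ j) = if k = j then a else 0 := by
  apply Subtype.ext
  change PowerSeries.coeff k (lastVarEquiv K n ((Dagger.incl p K n a).1 *
    MvPowerSeries.X (Fin.last n) ^ j)) = _
  rw [map_mul, map_pow, lastVarEquiv_X, Dagger.lastVarEquiv_incl, PowerSeries.coeff_C_mul,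
    PowerSeries.coeff_X_pow]
  split_ifs <;> simp

theorem Bounded.lastCoeff {ρ C : ℝ} (hρ : 1 ≤ ρ) {y : Dagger p K (n + 1)}
    (hy : Bounded ρ C y.1) (k : ℕ) : Bounded ρ C (Dagger.lastCoeff p K n k y).1 :=
  hy.coeff_lastVarEquiv hρ k

theorem Dagger.algebraMap_algebraMap_succ (a : RInt K) :
    algebraMap (Dagger p K n) (Dagger p K (n + 1)) (algebraMap (RInt K) (Dagger p K n) a) =
      algebraMap (RInt K) (Dagger p K (n + 1)) a :=
  (Dagger.incl p K n).commutes a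

/-- The coefficients of high powers of the last variable are divisible by a given power of `a`. -/
theorem Dagger.dvd_lastCoeff {a : RInt K} (ha0 : a ≠ 0) {ρ C : ℝ} (hρ : 1 ≤ ρ)
    {D J : ℕ} (hD : C ≤ ‖(a : K)‖ ^ J * ρ ^ D) {y : Dagger p K (n + 1)} (hy : Bounded ρ C y.1)
    {k : ℕ} (hk : D ≤ k) :
    algebraMap (RInt K) (Dagger p K n) a ^ J ∣ Dagger.lastCoeff p K n k y := by
  obtain ⟨t, ht, -⟩ := Dagger.exists_eq_mul (Dagger.lastCoeff p K n k y) (a ^ J)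
    (pow_ne_zero _ ha0) (fun x => by
      have h1 := (bounded_iff_snocIndex _).1 hy x k
      have h3 : 0 < ρ ^ (x.degree + k) := by positivity
      push_cast
      rw [norm_pow]
      refine le_of_mul_le_mul_right ((h1.trans hD).trans ?_) h3
      exact mul_le_mul_of_nonneg_left (pow_le_pow_right₀ hρ (by omega)) (by positivity))
  exact ⟨t, by rw [ht, map_pow]⟩

/-- Modulo `a^J`, an overconvergent series is a polynomial in the last variable, of controlled
degree. -/
theorem Dagger.dvd_sub_sum_lastCoeff {a : RInt K} (ha0 : a ≠ 0) {ρ C : ℝ} (hρ : 1 ≤ ρ)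
    {D J : ℕ} (hD : C ≤ ‖(a : K)‖ ^ J * ρ ^ D) {y : Dagger p K (n + 1)} (hy : Bounded ρ C y.1) :
    algebraMap (RInt K) (Dagger p K (n + 1)) a ^ J ∣ y - ∑ k ∈ Finset.range D,
      algebraMap (Dagger p K n) (Dagger p K (n + 1)) (Dagger.lastCoeff p K n k y) *
        Dagger.X (Fin.last n) ^ k := by
  set y' := y - ∑ k ∈ Finset.range D,
      algebraMap (Dagger p K n) (Dagger p K (n + 1)) (Dagger.lastCoeff p K n k y) *
        Dagger.X (Fin.last n) ^ k with hy'
  have hco : ∀ k, Dagger.lastCoeff p K n k y' =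
      if k < D then 0 else Dagger.lastCoeff p K n k y := by
    intro k
    rw [hy', map_sub, map_sum]
    simp only [Dagger.lastCoeff_algebraMap_mul_X_pow, Finset.sum_ite_eq, Finset.mem_range]
    split_ifs <;> simp
  obtain ⟨t, ht, -⟩ := Dagger.exists_eq_mul y' (a ^ J)
    (pow_ne_zero _ ha0) (fun v => by
      obtain ⟨x, k, rfl⟩ := exists_eq_snocIndex v
      rw [← coeff_coeff_lastVarEquiv, ← Dagger.coe_lastCoeff (p := p), hco]
      split_ifs with hk
      · simp
      · obtain ⟨t, ht⟩ := Dagger.dvd_lastCoeff ha0 hρ hD hy (not_lt.1 hk)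
        rw [ht, ← map_pow, Dagger.coeff_algebraMap_mul]
        push_cast
        rw [norm_mul]
        exact mul_le_of_le_one_right (by positivity) (norm_coe_le_one _))
  exact ⟨t, by rw [ht, map_pow]⟩

/-- A bound is absorbed by `a^J ρ^D` for large `D`. -/
theorem exists_le_pow_mul_pow {a : RInt K} (ha0 : a ≠ 0) {ρ : ℝ} (hρ : 1 < ρ) (C : ℝ) (J : ℕ) :
    ∃ D₀ : ℕ, ∀ D, D₀ ≤ D → C ≤ ‖(a : K)‖ ^ J * ρ ^ D := by
  have ha' : 0 < ‖(a : K)‖ := norm_pos_iff.2 (by simpa using ha0)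
  obtain ⟨D₀, hD₀⟩ := pow_unbounded_of_one_lt (C / ‖(a : K)‖ ^ J) hρ
  refine ⟨D₀, fun D hD => ?_⟩
  rw [div_lt_iff₀ (by positivity)] at hD₀
  rw [mul_comm]
  exact hD₀.le.trans (mul_le_mul_of_nonneg_right (pow_le_pow_right₀ hρ.le hD) (by positivity))

theorem Dagger.lastCoeff_scale {a : RInt K} (ha0 : a ≠ 0) (ha : ‖(a : K)‖ < 1)
    (G : Dagger p K n) (k : ℕ) (y : Dagger p K (n + 1)) :
    Dagger.lastCoeff p K n k (Dagger.scale G y) = G ^ k * Dagger.lastCoeff p K n k y := by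
  rw [← sub_eq_zero]
  refine Dagger.eq_zero_of_forall_dvd ha fun J => ?_
  obtain ⟨ρ, C, hρ, -, hy⟩ := y.exists_bounded
  obtain ⟨D₀, hD₀⟩ := exists_le_pow_mul_pow ha0 hρ C J
  obtain ⟨t, ht⟩ := Dagger.dvd_sub_sum_lastCoeff ha0 hρ.le
    (hD₀ (D₀ + k + 1) (by omega)) hy
  set P := ∑ k ∈ Finset.range (D₀ + k + 1),
      algebraMap (Dagger p K n) (Dagger p K (n + 1)) (Dagger.lastCoeff p K n k y) *
        Dagger.X (Fin.last n) ^ k with hP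
  have h1 : Dagger.lastCoeff p K n k (Dagger.scale G P) =
      G ^ k * Dagger.lastCoeff p K n k P := by
    rw [hP]
    simp only [map_sum, map_mul, map_pow, Dagger.scale_X_last, AlgHom.commutes, mul_pow]
    simp only [← map_pow, ← mul_assoc, ← map_mul, Dagger.lastCoeff_algebraMap_mul_X_pow,
      Finset.mul_sum]
    refine Finset.sum_congr rfl fun j _ => ?_
    split_ifs with h
    · rw [h, mul_comm]
    · rw [mul_zero]
  have hw : algebraMap (RInt K) (Dagger p K (n + 1)) a ^ J =
      algebraMap (Dagger p K n) (Dagger p K (n + 1)) (algebraMap (RInt K) (Dagger p K n) a ^ J) := by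
    rw [map_pow, Dagger.algebraMap_algebraMap_succ]
  rw [sub_eq_iff_eq_add, hw] at ht
  refine ⟨Dagger.lastCoeff p K n k (Dagger.scale G t) - G ^ k * Dagger.lastCoeff p K n k t, ?_⟩
  rw [ht, map_add, map_add, map_add, h1, map_mul, AlgHom.commutes,
    Dagger.lastCoeff_algebraMap_mul, Dagger.lastCoeff_algebraMap_mul]
  ring

end LastVariable

/-! ### Powers of sums -/

section Powers

variable {p : ℕ} [Fact p.Prime] {K : Type*} [NormedField K] [IsUltrametricDist K] {n : ℕ}

theorem bounded_natCast (ρ : ℝ) (k : ℕ) : Bounded ρ 1 (k : Dagger p K n).1 := by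
  have h : (k : Dagger p K n) = algebraMap (RInt K) (Dagger p K n) k := (map_natCast _ k).symm
  rw [h]
  exact bounded_algebraMap ρ _

theorem bounded_prod_pow {ι : Type*} (s : Finset ι) {y : ι → Dagger p K n} {ρ B : ℝ}
    (hρ : 0 ≤ ρ) (hy : ∀ i, Bounded ρ B (y i).1) (e : ι → ℕ) :
    Bounded ρ (B ^ ∑ i ∈ s, e i) (∏ i ∈ s, y i ^ e i).1 := by
  classical
  induction s using Finset.induction_on with
  | empty => simpa using bounded_one ρ
  | insert i s hi ih =>
    rw [Finset.prod_insert hi, Finset.sum_insert hi, pow_add]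
    exact ((hy i).pow hρ _).mul hρ ih

/-- A high power of `∑ y_i` is a combination of the `y_i^D`, with coefficients bounded
exponentially in `D`. -/
theorem exists_sum_pow_eq {r : ℕ} {y : Fin r → Dagger p K n} {ρ B : ℝ} (hρ : 0 ≤ ρ) (hB : 1 ≤ B)
    (hy : ∀ i, Bounded ρ B (y i).1) (D : ℕ) :
    ∃ A : Fin r → Dagger p K n, (∀ i, Bounded ρ (B ^ (r * D + 1)) (A i).1) ∧
      (∑ i, y i) ^ (r * D + 1) = ∑ i, A i * y i ^ D := by
  classical
  have hB0 : 0 ≤ B := by linarith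
  rw [Finset.sum_pow_eq_sum_piAntidiag]
  refine Finset.sum_induction _ (fun z => ∃ A : Fin r → Dagger p K n,
    (∀ i, Bounded ρ (B ^ (r * D + 1)) (A i).1) ∧ z = ∑ i, A i * y i ^ D) ?_ ?_ ?_
  · rintro _ _ ⟨A, hA, rfl⟩ ⟨A', hA', rfl⟩
    refine ⟨A + A', fun i => (hA i).add hρ (hA' i), ?_⟩
    simp only [Pi.add_apply, add_mul, Finset.sum_add_distrib]
  · exact ⟨0, fun i => bounded_zero (by positivity), by simp⟩
  · intro k hk
    rw [Finset.mem_piAntidiag] at hk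
    -- The exponents add up to more than `r D`, so one of them is at least `D`.
    obtain ⟨i, hi⟩ : ∃ i, D ≤ k i := by
      by_contra! hlt
      have h1 : ∑ i, k i ≤ ∑ _i : Fin r, D := Finset.sum_le_sum fun i _ => (hlt i).le
      simp only [Finset.sum_const, Finset.card_univ, Fintype.card_fin, smul_eq_mul] at h1
      have h2 : ∑ i, k i = r * D + 1 := hk.1
      omega
    have hsum : k i + ∑ j ∈ Finset.univ.erase i, k j = r * D + 1 := by
      rw [Finset.add_sum_erase _ _ (Finset.mem_univ i)]
      exact hk.1
    refine ⟨Pi.single i (Nat.multinomial Finset.univ k *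
      (y i ^ (k i - D) * ∏ j ∈ Finset.univ.erase i, y j ^ k j)), fun j => ?_, ?_⟩
    · by_cases hj : j = i
      · subst hj
        rw [Pi.single_eq_same]
        refine (Bounded.mul hρ (bounded_natCast ρ _) (((hy j).pow hρ _).mul hρ
          (bounded_prod_pow _ hρ hy k))).mono hρ le_rfl ?_
        rw [one_mul, ← pow_add]
        exact pow_le_pow_right₀ hB (by omega)
      · rw [Pi.single_eq_of_ne hj]
        exact bounded_zero (by positivity)
    · rw [Finset.sum_eq_single i (fun j _ hj => by rw [Pi.single_eq_of_ne hj, zero_mul])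
        (fun h => absurd (Finset.mem_univ i) h), Pi.single_eq_same,
        ← Finset.mul_prod_erase _ _ (Finset.mem_univ i)]
      conv_lhs => rw [← Nat.sub_add_cancel hi, pow_add]
      ring

end Powers

/-! ### The coefficient ring -/

section CoefficientRing

variable {K : Type*} [NormedField K] [IsUltrametricDist K]

theorem exists_eq_mul_of_norm_le {a x : RInt K} (ha : a ≠ 0) (h : ‖(x : K)‖ ≤ ‖(a : K)‖) :
    ∃ c, x = a * c := by
  have ha' : 0 < ‖(a : K)‖ := norm_pos_iff.2 (by simpa using ha)
  refine ⟨⟨(x : K) / a, ?_⟩, ?_⟩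
  · have : ‖(x : K) / a‖ ≤ 1 := by
      rw [norm_div]
      exact div_le_one_of_le₀ h ha'.le
    exact this
  · apply Subtype.ext
    push_cast
    rw [mul_div_cancel₀]
    exact norm_pos_iff.1 ha'

/-- The ring of integers of a finite extension of `ℚ_p` has an element of largest norm less
than `1`, by compactness of the open unit ball. -/
theorem exists_uniformizer (p : ℕ) [Fact p.Prime] [NormedAlgebra ℚ_[p] K]
    [FiniteDimensional ℚ_[p] K] :
    ∃ a : RInt K, a ≠ 0 ∧ ‖(a : K)‖ < 1 ∧ ∀ x : RInt K, ‖(x : K)‖ < 1 → ‖(x : K)‖ ≤ ‖(a : K)‖ := by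
  have : ProperSpace K := FiniteDimensional.proper ℚ_[p] K
  have hcomp : IsCompact (Metric.ball (0 : K) 1) :=
    (isCompact_closedBall (0 : K) 1).of_isClosed_subset
      (IsUltrametricDist.isClosed_ball 0 1) Metric.ball_subset_closedBall
  have hp : ‖algebraMap ℚ_[p] K p‖ = (p : ℝ)⁻¹ := by
    rw [norm_algebraMap', Padic.norm_p]
  have hp1 : (1 : ℝ) < p := by exact_mod_cast (Fact.out : p.Prime).one_lt
  obtain ⟨a, ha, hmax⟩ := hcomp.exists_isMaxOn ⟨0, by simp⟩ continuous_norm.continuousOn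
  rw [mem_ball_zero_iff] at ha
  refine ⟨⟨a, ha.le⟩, ?_, ha, fun x hx => hmax (by simpa using hx)⟩
  intro h0
  have ha0 : a = 0 := congrArg Subtype.val h0
  have h1 : ‖algebraMap ℚ_[p] K p‖ ≤ ‖a‖ := hmax (by
    rw [mem_ball_zero_iff, hp]
    exact inv_lt_one_of_one_lt₀ hp1)
  rw [hp, ha0, norm_zero] at h1
  have : 0 < (p : ℝ)⁻¹ := by positivity
  linarith

theorem isNoetherianRing_of_uniformizer {a : RInt K} (ha0 : a ≠ 0) (ha : ‖(a : K)‖ < 1)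
    (hmax : ∀ x : RInt K, ‖(x : K)‖ < 1 → ‖(x : K)‖ ≤ ‖(a : K)‖) :
    IsNoetherianRing (RInt K) := by
  have ha' : 0 < ‖(a : K)‖ := norm_pos_iff.2 (by simpa using ha0)
  refine (isNoetherianRing_iff_ideal_fg _).2 fun I => ?_
  by_cases hI : ∃ j, a ^ j ∈ I
  · classical
    have hj := Nat.find_spec hI
    refine ⟨{a ^ Nat.find hI}, le_antisymm ?_ ?_⟩
    · rw [Finset.coe_singleton, Ideal.span_le, Set.singleton_subset_iff]
      exact hj
    intro x hx
    rw [Finset.coe_singleton, Ideal.mem_span_singleton']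
    have key : ∀ k, k ≤ Nat.find hI → ∃ c, x = a ^ k * c := by
      intro k
      induction k with
      | zero => exact fun _ => ⟨x, by simp⟩
      | succ k ih =>
        intro hk
        obtain ⟨c, rfl⟩ := ih (by omega)
        have hc : ‖(c : K)‖ < 1 := by
          refine lt_of_le_of_ne (norm_coe_le_one c) fun h1 => ?_
          obtain ⟨d, hd⟩ := exists_eq_mul_of_norm_le (a := c) (x := 1)
            (fun h => by simp [h] at h1) (by rw [h1]; simp)
          refine Nat.find_min hI (m := k) (by omega) ?_
          have := I.mul_mem_right d hx
          rwa [mul_assoc, ← hd, mul_one] at this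
        obtain ⟨d, hd⟩ := exists_eq_mul_of_norm_le ha0 (hmax c hc)
        exact ⟨d, by rw [hd, pow_succ, mul_assoc]⟩
    obtain ⟨c, hc⟩ := key _ le_rfl
    exact ⟨c, by rw [hc, mul_comm]⟩
  · have hbot : I = ⊥ := by
      refine (Submodule.eq_bot_iff _).2 fun x hx => ?_
      by_contra hx0
      have hx' : 0 < ‖(x : K)‖ := norm_pos_iff.2 (by simpa using hx0)
      obtain ⟨j, hj⟩ := exists_pow_lt_of_lt_one hx' ha
      obtain ⟨c, hc⟩ := exists_eq_mul_of_norm_le (a := x) (x := a ^ j) hx0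
        (by push_cast; rw [norm_pow]; exact hj.le)
      exact hI ⟨j, hc ▸ I.mul_mem_right c hx⟩
    rw [hbot]
    exact Submodule.fg_bot

/-- A radical membership in `A ⊗_R k`, written out in `A`. -/
theorem exists_pow_eq_of_mem_radical {a : RInt K} (ha0 : a ≠ 0)
    (hmax : ∀ x : RInt K, ‖(x : K)‖ < 1 → ‖(x : K)‖ ≤ ‖(a : K)‖)
    {A : Type*} [CommRing A] [Algebra (RInt K) A] {f : A} {r : ℕ} {g : Fin r → A}
    (hrad : algebraMap A (A ⊗[RInt K] IsLocalRing.ResidueField (RInt K)) f ∈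
      (Ideal.span (Set.range fun i =>
        algebraMap A (A ⊗[RInt K] IsLocalRing.ResidueField (RInt K)) (g i))).radical) :
    ∃ (N : ℕ) (c : Fin r → A) (h : A),
      f ^ N = ∑ i, c i * g i + algebraMap (RInt K) A a * h := by
  let I : Ideal A := Ideal.span {algebraMap (RInt K) A a}
  have hker : ∀ x ∈ IsLocalRing.maximalIdeal (RInt K), algebraMap (RInt K) (A ⧸ I) x = 0 := by
    intro x hx
    have hx1 : ‖(x : K)‖ < 1 := by
      refine lt_of_le_of_ne (norm_coe_le_one x) fun h1 => ?_
      obtain ⟨d, hd⟩ := exists_eq_mul_of_norm_le (a := x) (x := 1)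
        (fun h => by simp [h] at h1) (by rw [h1]; simp)
      exact (IsLocalRing.mem_maximalIdeal x).1 hx (IsUnit.of_mul_eq_one d hd.symm)
    obtain ⟨d, rfl⟩ := exists_eq_mul_of_norm_le ha0 (hmax x hx1)
    rw [IsScalarTower.algebraMap_apply (RInt K) A (A ⧸ I), Ideal.Quotient.algebraMap_eq,
      Ideal.Quotient.eq_zero_iff_mem, map_mul]
    exact I.mul_mem_right _ (Ideal.mem_span_singleton_self _)
  let φ : IsLocalRing.ResidueField (RInt K) →ₐ[RInt K] A ⧸ I :=
    Ideal.Quotient.liftₐ (IsLocalRing.maximalIdeal (RInt K)) (Algebra.ofId (RInt K) (A ⧸ I)) hker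
  let ψ : A ⊗[RInt K] IsLocalRing.ResidueField (RInt K) →ₐ[RInt K] A ⧸ I :=
    Algebra.TensorProduct.lift (Ideal.Quotient.mkₐ (RInt K) I) φ (fun _ _ => Commute.all _ _)
  have hψ : ∀ x : A, ψ (algebraMap A _ x) = Ideal.Quotient.mk I x := by
    intro x
    rw [Algebra.TensorProduct.algebraMap_apply, Algebra.TensorProduct.lift_tmul, map_one, mul_one]
    rfl
  obtain ⟨N, hN⟩ := hrad
  have h1 := Ideal.mem_map_of_mem ψ hN
  rw [map_pow, hψ, Ideal.map_span, ← Set.range_comp] at h1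
  obtain ⟨c, hc⟩ := (Ideal.mem_span_range_iff_exists_fun).1 h1
  choose c' hc' using fun i => Ideal.Quotient.mk_surjective (c i)
  have h2 : Ideal.Quotient.mk I (f ^ N - ∑ i, c' i * g i) = 0 := by
    rw [map_sub, map_pow, ← hc, map_sum, sub_eq_zero]
    refine Finset.sum_congr rfl fun i _ => ?_
    rw [map_mul, hc', Function.comp_apply, hψ]
  obtain ⟨h, hh⟩ := Ideal.mem_span_singleton'.1 (Ideal.Quotient.eq_zero_iff_mem.1 h2)
  exact ⟨N, c', h, by rw [mul_comm, hh]; ring⟩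

end CoefficientRing

/-! ### Clearing denominators -/

section Horner

variable {p : ℕ} [Fact p.Prime] {K : Type*} [NormedField K] [IsUltrametricDist K] {n : ℕ}

/-- The map `∑_k y_k ξ_{n+1}^k ↦ ∑_{k ≤ D} F^(D-k) y_k`: multiplication by `F^D` and evaluation of
the last variable at `F⁻¹`, except that the terms of degree more than `D` are dropped. -/
def Dagger.horner (F : Dagger p K n) (D : ℕ) : Dagger p K (n + 1) →ₗ[Dagger p K n] Dagger p K n :=
  ∑ k ∈ Finset.range (D + 1), F ^ (D - k) • Dagger.lastCoeff p K n k

theorem Dagger.horner_apply (F : Dagger p K n) (D : ℕ) (y : Dagger p K (n + 1)) :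
    Dagger.horner F D y =
      ∑ k ∈ Finset.range (D + 1), F ^ (D - k) * Dagger.lastCoeff p K n k y := by
  simp [Dagger.horner, LinearMap.sum_apply]

theorem Dagger.horner_zero (F : Dagger p K n) (y : Dagger p K (n + 1)) :
    Dagger.horner F 0 y = Dagger.lastCoeff p K n 0 y := by
  simp [Dagger.horner_apply]

theorem Dagger.horner_succ (F : Dagger p K n) (D : ℕ) (y : Dagger p K (n + 1)) :
    Dagger.horner F (D + 1) y =
      F * Dagger.horner F D y + Dagger.lastCoeff p K n (D + 1) y := by
  rw [Dagger.horner_apply, Finset.sum_range_succ, Nat.sub_self, pow_zero, one_mul,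
    Dagger.horner_apply, Finset.mul_sum]
  congr 1
  refine Finset.sum_congr rfl fun k hk => ?_
  rw [Finset.mem_range] at hk
  rw [← mul_assoc, ← pow_succ', Nat.succ_sub (by omega)]

theorem Dagger.horner_scale {a : RInt K} (ha0 : a ≠ 0) (ha : ‖(a : K)‖ < 1)
    (F G : Dagger p K n) (D : ℕ) (y : Dagger p K (n + 1)) :
    Dagger.horner (F * G) D (Dagger.scale G y) = G ^ D * Dagger.horner F D y := by
  rw [Dagger.horner_apply, Dagger.horner_apply, Finset.mul_sum]
  refine Finset.sum_congr rfl fun k hk => ?_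
  rw [Finset.mem_range] at hk
  rw [Dagger.lastCoeff_scale ha0 ha, mul_pow]
  have : G ^ D = G ^ (D - k) * G ^ k := by rw [← pow_add, Nat.sub_add_cancel (by omega)]
  rw [this]
  ring

theorem Bounded.horner {ρ C B : ℝ} (hρ : 1 ≤ ρ) (hB : 1 ≤ B) {F : Dagger p K n}
    (hF : Bounded ρ B F.1) {y : Dagger p K (n + 1)} (hy : Bounded ρ C y.1) (D : ℕ) :
    Bounded ρ (B ^ D * C) (Dagger.horner F D y).1 := by
  have hC := hy.nonneg
  have hρ0 : 0 ≤ ρ := by linarith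
  rw [Dagger.horner_apply]
  refine bounded_sum _ hρ0 (by positivity) fun k _ => ?_
  refine ((hF.pow hρ0 _).mul hρ0 (hy.lastCoeff hρ k)).mono hρ0 le_rfl ?_
  exact mul_le_mul_of_nonneg_right (pow_le_pow_right₀ hB (Nat.sub_le _ _)) hC

end Horner

/-! ### The modules `A⟨f⁻¹⟩† ⊗ M` -/

section LocTensor

variable {p : ℕ} [Fact p.Prime] {K : Type*} [NormedField K] [IsUltrametricDist K] {n m : ℕ}
  {A : Type*} [CommRing A] [Algebra (Dagger p K n) A]

/-- The canonical map `T_{n+1}† → A⟨f⁻¹⟩†`. -/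
def Loc.ofDagger (f : A) : Dagger p K (n + 1) →+* Loc p K n f :=
  (Loc.mk p K n f).toRingHom.comp
    (Algebra.TensorProduct.includeRight :
      Dagger p K (n + 1) →ₐ[Dagger p K n] Adjoin p K n A).toRingHom

theorem Loc.ofDagger_apply (f : A) (y : Dagger p K (n + 1)) :
    Loc.ofDagger f y = Loc.mk p K n f (1 ⊗ₜ y) := rfl

theorem Loc.ofDagger_algebraMap (f : A) (a : Dagger p K n) :
    Loc.ofDagger f (algebraMap (Dagger p K n) (Dagger p K (n + 1)) a) =
      algebraMap A (Loc p K n f) (algebraMap (Dagger p K n) A a) := by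
  rw [Loc.ofDagger_apply, ← AlgHom.commutes (Loc.mk p K n f),
    Algebra.TensorProduct.algebraMap_apply, Algebra.algebraMap_self_apply]
  exact congrArg _ (Algebra.TensorProduct.tmul_one_eq_one_tmul a).symm

theorem Loc.ofDagger_X (f : A) :
    Loc.ofDagger f (Dagger.X (Fin.last n) : Dagger p K (n + 1)) = Loc.var f := rfl

theorem Adjoin.exists_eq_one_tmul (hA : Function.Surjective (algebraMap (Dagger p K n) A))
    (x : Adjoin p K n A) : ∃ y : Dagger p K (n + 1), x = 1 ⊗ₜ y := by
  induction x using TensorProduct.induction_on with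
  | zero => exact ⟨0, by rw [TensorProduct.tmul_zero]⟩
  | tmul a t =>
    obtain ⟨G, rfl⟩ := hA a
    refine ⟨algebraMap (Dagger p K n) (Dagger p K (n + 1)) G * t, ?_⟩
    have h := congrArg (· * (1 : A) ⊗ₜ[Dagger p K n] t)
      (Algebra.TensorProduct.tmul_one_eq_one_tmul (A := A) (B := Dagger p K (n + 1)) G)
    simpa only [Algebra.TensorProduct.tmul_mul_tmul, mul_one, one_mul] using h
  | add x y hx hy =>
    obtain ⟨s, rfl⟩ := hx
    obtain ⟨t, rfl⟩ := hy
    exact ⟨s + t, by rw [TensorProduct.tmul_add]⟩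

theorem Loc.ofDagger_surjective (hA : Function.Surjective (algebraMap (Dagger p K n) A)) (f : A) :
    Function.Surjective (Loc.ofDagger (p := p) (K := K) (n := n) f) := by
  intro x
  obtain ⟨x, rfl⟩ := Loc.mk_surjective p K n f x
  obtain ⟨y, rfl⟩ := Adjoin.exists_eq_one_tmul hA x
  exact ⟨y, rfl⟩

theorem Loc.exists_res_ofDagger (hA : Function.Surjective (algebraMap (Dagger p K n) A)) {a b : A}
    (h : a ∣ b) : ∃ G : Dagger p K n, b = a * algebraMap (Dagger p K n) A G ∧
      ∀ y : Dagger p K (n + 1), Loc.res hA h (Loc.ofDagger a y) =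
        Loc.ofDagger b (Dagger.scale G y) := by
  refine ⟨(exists_factor hA h).choose, (exists_factor hA h).choose_spec, fun y => ?_⟩
  rw [Loc.ofDagger_apply, Loc.res, Loc.resOf_mk, Adjoin.scale, Algebra.TensorProduct.map_tmul,
    map_one, Loc.ofDagger_apply]

variable (p K n A) in
/-- The coefficient of `ξ^k` in `A⟨ξ⟩†`. -/
def Adjoin.lastCoeff (k : ℕ) : Adjoin p K n A →ₗ[A] A :=
  (Algebra.TensorProduct.rid (Dagger p K n) A A).toLinearMap ∘ₗ
    (Dagger.lastCoeff p K n k).baseChange A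

theorem Adjoin.lastCoeff_tmul (k : ℕ) (a : A) (y : Dagger p K (n + 1)) :
    Adjoin.lastCoeff p K n A k (a ⊗ₜ y) =
      algebraMap (Dagger p K n) A (Dagger.lastCoeff p K n k y) * a := by
  rw [Adjoin.lastCoeff, LinearMap.comp_apply, LinearMap.baseChange_tmul]
  change (Algebra.TensorProduct.rid (Dagger p K n) A A) _ = _
  rw [Algebra.TensorProduct.rid_tmul, Algebra.smul_def]

theorem Adjoin.mul_tmul (f a : A) (y : Dagger p K (n + 1)) :
    (algebraMap A (Adjoin p K n A) f * Adjoin.var p K n A - 1) * (a ⊗ₜ y) =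
      (f * a) ⊗ₜ (Dagger.X (Fin.last n) * y) - a ⊗ₜ y := by
  rw [sub_mul, one_mul, Algebra.TensorProduct.algebraMap_apply, Algebra.algebraMap_self_apply,
    Adjoin.var, Algebra.TensorProduct.tmul_mul_tmul, Algebra.TensorProduct.tmul_mul_tmul,
    mul_one, one_mul]

theorem Adjoin.lastCoeff_succ_mul (f : A) (k : ℕ) (x : Adjoin p K n A) :
    Adjoin.lastCoeff p K n A (k + 1)
      ((algebraMap A (Adjoin p K n A) f * Adjoin.var p K n A - 1) * x) =
      f * Adjoin.lastCoeff p K n A k x - Adjoin.lastCoeff p K n A (k + 1) x := by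
  induction x using TensorProduct.induction_on with
  | zero => simp
  | tmul a y =>
    rw [Adjoin.mul_tmul, map_sub, Adjoin.lastCoeff_tmul, Adjoin.lastCoeff_tmul,
      Adjoin.lastCoeff_tmul, Dagger.lastCoeff_X_mul]
    ring
  | add x y hx hy =>
    rw [mul_add, map_add, hx, hy, map_add, map_add]
    ring

theorem Adjoin.lastCoeff_zero_mul (f : A) (x : Adjoin p K n A) :
    Adjoin.lastCoeff p K n A 0
      ((algebraMap A (Adjoin p K n A) f * Adjoin.var p K n A - 1) * x) =
      - Adjoin.lastCoeff p K n A 0 x := by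
  induction x using TensorProduct.induction_on with
  | zero => simp
  | tmul a y =>
    rw [Adjoin.mul_tmul, map_sub, Adjoin.lastCoeff_tmul, Adjoin.lastCoeff_tmul,
      Dagger.lastCoeff_zero_X_mul, map_zero]
    ring
  | add x y hx hy =>
    rw [mul_add, map_add, hx, hy, map_add]
    ring

variable {M : Type*} [AddCommGroup M] [Module A M]

/-- The combination `∑ v_i e_i` of elements of an `A`-module with coefficients in `T_n†`. -/
def evalTuple (e : Fin m → M) (v : Fin m → Dagger p K n) : M :=
  ∑ i, algebraMap (Dagger p K n) A (v i) • e i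

theorem evalTuple_add (e : Fin m → M) (v v' : Fin m → Dagger p K n) :
    evalTuple (A := A) e (fun i => v i + v' i) =
      evalTuple (A := A) e v + evalTuple (A := A) e v' := by
  simp only [evalTuple, map_add, add_smul, Finset.sum_add_distrib]

theorem evalTuple_sub (e : Fin m → M) (v v' : Fin m → Dagger p K n) :
    evalTuple (A := A) e (fun i => v i - v' i) =
      evalTuple (A := A) e v - evalTuple (A := A) e v' := by
  simp only [evalTuple, map_sub, sub_smul, Finset.sum_sub_distrib]

theorem evalTuple_mul (e : Fin m → M) (c : Dagger p K n) (v : Fin m → Dagger p K n) :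
    evalTuple (A := A) e (fun i => c * v i) =
      algebraMap (Dagger p K n) A c • evalTuple (A := A) e v := by
  simp only [evalTuple, map_mul, mul_smul, Finset.smul_sum]

theorem evalTuple_sum {ι : Type*} (s : Finset ι) (e : Fin m → M)
    (v : ι → Fin m → Dagger p K n) :
    evalTuple (A := A) e (fun i => ∑ j ∈ s, v j i) = ∑ j ∈ s, evalTuple (A := A) e (v j) := by
  simp only [evalTuple, map_sum, Finset.sum_smul]
  exact Finset.sum_comm

/-- For elements `e_1, …, e_m` of `M`, the map `y ↦ ∑ y_i ⊗ e_i` from the tuples over `T_{n+1}†` to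
`A⟨f⁻¹⟩† ⊗ M`. -/
def tensorTuple (e : Fin m → M) (f : A) :
    (Fin m → Dagger p K (n + 1)) →ₛₗ[Loc.ofDagger (p := p) (K := K) (n := n) f] Loc p K n f ⊗[A] M where
  toFun y := ∑ i, Loc.ofDagger f (y i) ⊗ₜ[A] e i
  map_add' x y := by
    simp only [Pi.add_apply, map_add, TensorProduct.add_tmul, Finset.sum_add_distrib]
  map_smul' c y := by
    simp only [Pi.smul_apply, smul_eq_mul, map_mul, Finset.smul_sum, TensorProduct.smul_tmul']

theorem tensorTuple_apply (e : Fin m → M) (f : A) (y : Fin m → Dagger p K (n + 1)) :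
    tensorTuple e f y = ∑ i, Loc.ofDagger f (y i) ⊗ₜ[A] e i := rfl

theorem tensorTuple_algebraMap (e : Fin m → M) (f : A) (v : Fin m → Dagger p K n) :
    tensorTuple e f (fun i => algebraMap (Dagger p K n) (Dagger p K (n + 1)) (v i)) =
      (1 : Loc p K n f) ⊗ₜ[A] evalTuple (A := A) e v := by
  rw [tensorTuple_apply, evalTuple, TensorProduct.tmul_sum]
  refine Finset.sum_congr rfl fun i _ => ?_
  rw [Loc.ofDagger_algebraMap, TensorProduct.tmul_smul, TensorProduct.smul_tmul',
    Algebra.smul_def, mul_one]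

theorem exists_eq_sum_tmul {B : Type*} [AddCommGroup B] [Module A B] {e : Fin m → M}
    (he : Submodule.span A (Set.range e) = ⊤) (x : B ⊗[A] M) :
    ∃ b : Fin m → B, x = ∑ i, b i ⊗ₜ[A] e i := by
  induction x with
  | zero => exact ⟨0, by simp⟩
  | tmul b u =>
    obtain ⟨c, hc⟩ := (Submodule.mem_span_range_iff_exists_fun A).1
      (show u ∈ Submodule.span A (Set.range e) from he ▸ Submodule.mem_top)
    refine ⟨fun i => c i • b, ?_⟩
    rw [← hc, TensorProduct.tmul_sum]
    exact Finset.sum_congr rfl fun i _ => (TensorProduct.smul_tmul _ _ _).symm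
  | add x y hx hy =>
    obtain ⟨b, rfl⟩ := hx
    obtain ⟨c, rfl⟩ := hy
    exact ⟨b + c, by simp only [Pi.add_apply, TensorProduct.add_tmul, Finset.sum_add_distrib]⟩

theorem tensorTuple_surjective (hA : Function.Surjective (algebraMap (Dagger p K n) A))
    {e : Fin m → M} (he : Submodule.span A (Set.range e) = ⊤) (f : A) :
    Function.Surjective (tensorTuple (p := p) (K := K) (n := n) e f) := by
  intro x
  obtain ⟨b, rfl⟩ := exists_eq_sum_tmul he x
  choose y hy using fun i => Loc.ofDagger_surjective hA f (b i)
  exact ⟨y, by simp only [tensorTuple_apply, hy]⟩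

/-- Relations in `A⟨f⁻¹⟩† ⊗ M` come from multiples of `f ξ - 1`. -/
theorem exists_of_tensorTuple_eq_zero (hA : Function.Surjective (algebraMap (Dagger p K n) A))
    {e : Fin m → M} (he : Submodule.span A (Set.range e) = ⊤) {f : A}
    {y : Fin m → Dagger p K (n + 1)} (hy : tensorTuple e f y = 0) :
    ∃ w : Fin m → Dagger p K (n + 1),
      (∀ k, evalTuple (A := A) e (fun i => Dagger.lastCoeff p K n (k + 1) (y i)) =
        f • evalTuple (A := A) e (fun i => Dagger.lastCoeff p K n k (w i)) -
          evalTuple (A := A) e (fun i => Dagger.lastCoeff p K n (k + 1) (w i))) ∧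
      evalTuple (A := A) e (fun i => Dagger.lastCoeff p K n 0 (y i)) =
        - evalTuple (A := A) e (fun i => Dagger.lastCoeff p K n 0 (w i)) := by
  let μ : Adjoin p K n A →ₗ[A] Adjoin p K n A :=
    LinearMap.mulLeft A (algebraMap A (Adjoin p K n A) f * Adjoin.var p K n A - 1)
  have hex : Function.Exact μ (Loc.mk p K n f).toLinearMap := by
    intro x
    change Loc.mk p K n f x = 0 ↔ _
    rw [Loc.mk_eq_zero_iff, locIdeal, Ideal.mem_span_singleton']
    constructor
    · rintro ⟨c, hc⟩
      exact ⟨c, by rw [← hc, mul_comm]; rfl⟩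
    · rintro ⟨c, hc⟩
      exact ⟨c, by rw [← hc, mul_comm]; rfl⟩
  have hex' := rTensor_exact M hex (Loc.mk_surjective p K n f)
  obtain ⟨W, hW⟩ := (hex' (∑ i, (1 ⊗ₜ[Dagger p K n] y i : Adjoin p K n A) ⊗ₜ[A] e i)).1 (by
    rw [map_sum]
    simp only [LinearMap.rTensor_tmul]
    exact hy)
  obtain ⟨b, rfl⟩ := exists_eq_sum_tmul he W
  choose w hw using fun i => Adjoin.exists_eq_one_tmul hA (b i)
  refine ⟨w, ?_, ?_⟩
  · intro k
    have h := congrArg (fun x => TensorProduct.lid A M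
      ((Adjoin.lastCoeff p K n A (k + 1)).rTensor M x)) hW
    simp only [map_sum, LinearMap.rTensor_tmul, TensorProduct.lid_tmul, μ,
      LinearMap.mulLeft_apply, Adjoin.lastCoeff_succ_mul, hw, Adjoin.lastCoeff_tmul, mul_one,
      sub_smul, mul_smul, Finset.sum_sub_distrib] at h
    rw [evalTuple, ← h, evalTuple, evalTuple, Finset.smul_sum]
  · have h := congrArg (fun x => TensorProduct.lid A M
      ((Adjoin.lastCoeff p K n A 0).rTensor M x)) hW
    simp only [map_sum, LinearMap.rTensor_tmul, TensorProduct.lid_tmul, μ,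
      LinearMap.mulLeft_apply, Adjoin.lastCoeff_zero_mul, hw, Adjoin.lastCoeff_tmul, mul_one,
      neg_smul, Finset.sum_neg_distrib] at h
    rw [evalTuple, ← h, evalTuple]

/-- If `y` vanishes in `A⟨f⁻¹⟩† ⊗ M`, then clearing its denominators with a power `f^D` gives the
coefficient of degree `D` of a fixed series, which is small for large `D`. -/
theorem exists_evalTuple_horner (hA : Function.Surjective (algebraMap (Dagger p K n) A))
    {e : Fin m → M} (he : Submodule.span A (Set.range e) = ⊤) {f : A}
    {F : Dagger p K n} (hf : f = algebraMap (Dagger p K n) A F)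
    {y : Fin m → Dagger p K (n + 1)} (hy : tensorTuple e f y = 0) :
    ∃ w : Fin m → Dagger p K (n + 1), ∀ D,
      evalTuple (A := A) e (fun i => Dagger.horner F D (y i)) =
        - evalTuple (A := A) e (fun i => Dagger.lastCoeff p K n D (w i)) := by
  obtain ⟨w, h1, h0⟩ := exists_of_tensorTuple_eq_zero hA he hy
  refine ⟨w, fun D => ?_⟩
  induction D with
  | zero => simpa only [Dagger.horner_zero] using h0
  | succ D ih =>
    simp only [Dagger.horner_succ]
    rw [evalTuple_add, evalTuple_mul, ih, h1, ← hf]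
    module

theorem Loc.var_pow_mul (f : A) (D : ℕ) :
    algebraMap A (Loc p K n f) f ^ D * Loc.var f ^ D = 1 := by
  rw [← mul_pow, Loc.mul_var, one_pow]

/-- In `A⟨f⁻¹⟩†` the map `Dagger.horner` is multiplication by `f^D` up to a small error. -/
theorem Loc.exists_pow_mul_ofDagger {a : RInt K} (ha0 : a ≠ 0) {ρ C : ℝ} (hρ : 1 ≤ ρ) {D J : ℕ}
    (hD : C ≤ ‖(a : K)‖ ^ J * ρ ^ D) {f : A} {F : Dagger p K n}
    (hf : f = algebraMap (Dagger p K n) A F) {y : Dagger p K (n + 1)} (hy : Bounded ρ C y.1) :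
    ∃ t : Loc p K n f,
      algebraMap A (Loc p K n f) f ^ D * Loc.ofDagger f y =
      algebraMap A _ (algebraMap (Dagger p K n) A (Dagger.horner F D y)) +
        algebraMap A _ (algebraMap (Dagger p K n) A (algebraMap (RInt K) (Dagger p K n) a) ^ J) *
          t := by
  have hC := hy.nonneg
  obtain ⟨t, ht⟩ := Dagger.dvd_sub_sum_lastCoeff (D := D + 1) ha0 hρ
    (hD.trans (mul_le_mul_of_nonneg_left (pow_le_pow_right₀ hρ (Nat.le_succ D)) (by positivity))) hy
  rw [sub_eq_iff_eq_add] at ht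
  refine ⟨algebraMap A _ f ^ D * Loc.ofDagger f t, ?_⟩
  have h0 := congrArg (Loc.ofDagger f) ht
  rw [h0, map_add, mul_add, add_comm]
  congr 1
  · rw [map_sum, Dagger.horner_apply, map_sum, map_sum, Finset.mul_sum]
    refine Finset.sum_congr rfl fun k hk => ?_
    rw [Finset.mem_range] at hk
    rw [map_mul, map_pow, Loc.ofDagger_X, Loc.ofDagger_algebraMap, map_mul, map_mul, map_pow,
      map_pow, ← hf]
    have h1 : algebraMap A (Loc p K n f) f ^ D =
        algebraMap A (Loc p K n f) f ^ (D - k) * algebraMap A (Loc p K n f) f ^ k := by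
      rw [← pow_add, Nat.sub_add_cancel (by omega)]
    rw [h1]
    linear_combination (algebraMap A (Loc p K n f) f ^ (D - k) * algebraMap A (Loc p K n f)
      (algebraMap (Dagger p K n) A (Dagger.lastCoeff p K n k y))) *
        Loc.var_pow_mul (p := p) (K := K) (n := n) f k
  · rw [map_mul, map_pow, ← Dagger.algebraMap_algebraMap_succ, Loc.ofDagger_algebraMap, map_pow]
    ring

end LocTensor

/-! ### Separatedness -/

section Separated

/-- The submodule `c M`. -/
def multiples {A : Type*} [CommRing A] (c : A) (M : Type*) [AddCommGroup M] [Module A M] :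
    Submodule A M :=
  LinearMap.range (LinearMap.lsmul A M c)

theorem mem_multiples {A : Type*} [CommRing A] {c : A} {M : Type*} [AddCommGroup M] [Module A M]
    {x : M} : x ∈ multiples c M ↔ ∃ y, c • y = x := Iff.rfl

theorem map_mem_multiples {A : Type*} [CommRing A] {c : A} {M N : Type*} [AddCommGroup M]
    [Module A M] [AddCommGroup N] [Module A N] (l : M →ₗ[A] N) {x : M} (hx : x ∈ multiples c M) :
    l x ∈ multiples c N := by
  obtain ⟨y, rfl⟩ := hx
  exact ⟨l y, (map_smul l c y).symm⟩

variable {p : ℕ} [Fact p.Prime] {K : Type*} [NormedField K] [IsUltrametricDist K] {n m : ℕ}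
  {A : Type*} [CommRing A] [Algebra (Dagger p K n) A]
  {M : Type*} [AddCommGroup M] [Module A M]

theorem smul_mem_multiples {f c : A} {x : Loc p K n f ⊗[A] M} (b : Loc p K n f)
    (hx : x ∈ multiples c (Loc p K n f ⊗[A] M)) : b • x ∈ multiples c (Loc p K n f ⊗[A] M) := by
  obtain ⟨y, rfl⟩ := hx
  exact ⟨b • y, smul_comm c b y⟩

theorem mem_multiples_of_smul_mem {f c d : A} {x : Loc p K n f ⊗[A] M} {b : Loc p K n f}
    (hb : algebraMap A (Loc p K n f) d * b = 1)
    (hx : d • x ∈ multiples c (Loc p K n f ⊗[A] M)) : x ∈ multiples c (Loc p K n f ⊗[A] M) := by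
  have h := smul_mem_multiples b hx
  rwa [← algebraMap_smul (Loc p K n f) d x, smul_smul, mul_comm, hb, one_smul] at h

variable (p n A) in
/-- The image in `A` of an element of the ring of integers. -/
abbrev constMap (a : RInt K) : A :=
  algebraMap (Dagger p K n) A (algebraMap (RInt K) (Dagger p K n) a)

theorem Loc.ofDagger_const (f : A) (a : RInt K) :
    Loc.ofDagger f (algebraMap (RInt K) (Dagger p K (n + 1)) a) =
      algebraMap A (Loc p K n f) (constMap p n A a) := by
  rw [← Dagger.algebraMap_algebraMap_succ, Loc.ofDagger_algebraMap]

theorem tensorTuple_pow_smul (e : Fin m → M) (f : A) (a : RInt K) (J : ℕ)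
    (t : Fin m → Dagger p K (n + 1)) :
    tensorTuple e f (algebraMap (RInt K) (Dagger p K (n + 1)) a ^ J • t) =
      constMap p n A a ^ J • tensorTuple e f t := by
  rw [map_smulₛₗ, map_pow, Loc.ofDagger_const, ← map_pow, algebraMap_smul]

variable [CompleteSpace K] [IsNoetherianRing (RInt K)] {a : RInt K}

/-- For finitely generated `M` the module `A⟨f⁻¹⟩† ⊗ M` is `a`-adically separated, being a finite
module over `T_{n+1}†`. -/
theorem eq_zero_of_forall_mem_multiples (ha0 : a ≠ 0) (ha : ‖(a : K)‖ < 1)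
    (hA : Function.Surjective (algebraMap (Dagger p K n) A))
    {e : Fin m → M} (he : Submodule.span A (Set.range e) = ⊤) {f : A} {x : Loc p K n f ⊗[A] M}
    (hx : ∀ J : ℕ, x ∈ multiples (constMap p n A a ^ J) (Loc p K n f ⊗[A] M)) : x = 0 := by
  obtain ⟨y, rfl⟩ := tensorTuple_surjective hA he f x
  refine mem_of_forall_exists_sub_mem ha0 ha (LinearMap.ker (tensorTuple e f)) (z := y) fun J => ?_
  obtain ⟨x', hx'⟩ := hx J
  obtain ⟨t, rfl⟩ := tensorTuple_surjective hA he f x'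
  refine ⟨t, ?_⟩
  rw [LinearMap.mem_ker, map_sub, tensorTuple_pow_smul, sub_eq_zero]
  exact hx'.symm

theorem Loc.eq_zero_of_forall_dvd (ha0 : a ≠ 0) (ha : ‖(a : K)‖ < 1)
    (hA : Function.Surjective (algebraMap (Dagger p K n) A)) {f : A} {x : Loc p K n f}
    (hx : ∀ J : ℕ, algebraMap A (Loc p K n f) (constMap p n A a ^ J) ∣ x) : x = 0 := by
  have h : x ⊗ₜ[A] (1 : A) = 0 := by
    refine eq_zero_of_forall_mem_multiples ha0 ha hA (e := fun _ : Fin 1 => (1 : A)) ?_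
      fun J => ?_
    · rw [Set.range_const]
      exact Ideal.span_singleton_one
    · obtain ⟨y, rfl⟩ := hx J
      exact ⟨y ⊗ₜ[A] 1, by
        change constMap p n A a ^ J • (y ⊗ₜ[A] (1 : A)) = _
        rw [TensorProduct.smul_tmul', Algebra.smul_def]⟩
  simpa using congrArg (TensorProduct.rid A (Loc p K n f)) h

/-- There is at most one homomorphism of `A`-algebras `A⟨b⁻¹⟩† → A⟨c⁻¹⟩†`: it is determined on
polynomials in the inverse of `b`, and the target is separated. -/
theorem Loc.algHom_ext (ha0 : a ≠ 0) (ha : ‖(a : K)‖ < 1)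
    (hA : Function.Surjective (algebraMap (Dagger p K n) A)) {b c : A}
    (φ ψ : Loc p K n b →ₐ[A] Loc p K n c) : φ = ψ := by
  have hvar : φ (Loc.var b) = ψ (Loc.var b) := by
    have h1 := congrArg φ (Loc.mul_var (p := p) (K := K) (n := n) b)
    have h2 := congrArg ψ (Loc.mul_var (p := p) (K := K) (n := n) b)
    rw [map_mul, AlgHom.commutes, map_one] at h1 h2
    rw [mul_comm] at h1
    exact left_inv_eq_right_inv h1 h2
  refine AlgHom.ext fun x => sub_eq_zero.1 (Loc.eq_zero_of_forall_dvd ha0 ha hA fun J => ?_)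
  obtain ⟨y, rfl⟩ := Loc.ofDagger_surjective hA b x
  obtain ⟨ρ, C, hρ, -, hy⟩ := y.exists_bounded
  obtain ⟨D, hD⟩ := exists_le_pow_mul_pow ha0 hρ C J
  obtain ⟨t, ht⟩ := Dagger.dvd_sub_sum_lastCoeff ha0 hρ.le (hD D le_rfl) hy
  rw [sub_eq_iff_eq_add] at ht
  have h0 := congrArg (Loc.ofDagger b) ht
  simp only [map_add, map_mul, map_pow, map_sum, Loc.ofDagger_X, Loc.ofDagger_algebraMap,
    Loc.ofDagger_const] at h0
  refine ⟨φ (Loc.ofDagger b t) - ψ (Loc.ofDagger b t), ?_⟩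
  rw [h0]
  simp only [map_add, map_mul, map_pow, map_sum, AlgHom.commutes, hvar]
  ring

end Separated

/-! ### Restriction maps -/

section Restriction

variable {p : ℕ} [Fact p.Prime] {K : Type*} [NormedField K] [IsUltrametricDist K] {n m : ℕ}
  {A : Type*} [CommRing A] [Algebra (Dagger p K n) A]
  {M : Type*} [AddCommGroup M] [Module A M] {a : RInt K}

theorem resTensor_tmul (hA : Function.Surjective (algebraMap (Dagger p K n) A)) {b c : A}
    (h : b ∣ c) (x : Loc p K n b) (u : M) :
    Loc.resTensor hA h M (x ⊗ₜ[A] u) = Loc.res hA h x ⊗ₜ[A] u := rfl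

theorem exists_resTensor_tensorTuple (hA : Function.Surjective (algebraMap (Dagger p K n) A))
    (e : Fin m → M) {b c : A} (h : b ∣ c) :
    ∃ G : Dagger p K n, c = b * algebraMap (Dagger p K n) A G ∧
      ∀ y : Fin m → Dagger p K (n + 1), Loc.resTensor hA h M (tensorTuple e b y) =
        tensorTuple e c (fun i => Dagger.scale G (y i)) := by
  obtain ⟨G, hG, hres⟩ := Loc.exists_res_ofDagger hA h
  refine ⟨G, hG, fun y => ?_⟩
  rw [tensorTuple_apply, tensorTuple_apply, map_sum]
  exact Finset.sum_congr rfl fun i _ => by rw [resTensor_tmul, hres]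

theorem evalTuple_horner_congr (e : Fin m → M) {F F' : Dagger p K n}
    (h : algebraMap (Dagger p K n) A F = algebraMap (Dagger p K n) A F') (D : ℕ)
    (y : Fin m → Dagger p K (n + 1)) :
    evalTuple (A := A) e (fun i => Dagger.horner F D (y i)) =
      evalTuple (A := A) e (fun i => Dagger.horner F' D (y i)) := by
  simp only [evalTuple, Dagger.horner_apply, map_sum, map_mul, map_pow, h]

theorem evalTuple_mem_multiples (e : Fin m → M) {J : ℕ} {v : Fin m → Dagger p K n}
    (hv : ∀ i, algebraMap (RInt K) (Dagger p K n) a ^ J ∣ v i) :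
    evalTuple (A := A) e v ∈ multiples (constMap p n A a ^ J) M := by
  refine Submodule.sum_mem _ fun i _ => ?_
  obtain ⟨t, ht⟩ := hv i
  exact mem_multiples.2 ⟨algebraMap (Dagger p K n) A t • e i, by
    rw [ht, map_mul, map_pow, mul_smul]⟩

theorem evalTuple_lastCoeff_mem_multiples (ha0 : a ≠ 0) (e : Fin m → M) {ρ C : ℝ} (hρ : 1 ≤ ρ)
    {D J : ℕ} (hD : C ≤ ‖(a : K)‖ ^ J * ρ ^ D) {y : Fin m → Dagger p K (n + 1)}
    (hy : ∀ i, Bounded ρ C (y i).1) :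
    evalTuple (A := A) e (fun i => Dagger.lastCoeff p K n D (y i)) ∈
      multiples (constMap p n A a ^ J) M :=
  evalTuple_mem_multiples e fun i => Dagger.dvd_lastCoeff ha0 hρ hD (hy i) le_rfl

theorem pow_smul_tensorTuple_sub_mem (ha0 : a ≠ 0) (e : Fin m → M) {ρ C : ℝ} (hρ : 1 ≤ ρ)
    {D J : ℕ} (hD : C ≤ ‖(a : K)‖ ^ J * ρ ^ D) {f : A} {F : Dagger p K n}
    (hf : f = algebraMap (Dagger p K n) A F) {y : Fin m → Dagger p K (n + 1)}
    (hy : ∀ i, Bounded ρ C (y i).1) :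
    f ^ D • tensorTuple e f y -
      (1 : Loc p K n f) ⊗ₜ[A] evalTuple (A := A) e (fun i => Dagger.horner F D (y i)) ∈
      multiples (constMap p n A a ^ J) (Loc p K n f ⊗[A] M) := by
  rw [tensorTuple_apply, evalTuple, TensorProduct.tmul_sum, Finset.smul_sum,
    ← Finset.sum_sub_distrib]
  refine Submodule.sum_mem _ fun i _ => ?_
  obtain ⟨t, ht⟩ := Loc.exists_pow_mul_ofDagger ha0 hρ hD hf (hy i)
  refine ⟨t ⊗ₜ[A] e i, ?_⟩
  change constMap p n A a ^ J • t ⊗ₜ[A] e i = _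
  rw [eq_sub_iff_add_eq, TensorProduct.tmul_smul, TensorProduct.smul_tmul',
    TensorProduct.smul_tmul', TensorProduct.smul_tmul', ← TensorProduct.add_tmul,
    Algebra.smul_def, Algebra.smul_def, Algebra.smul_def, map_pow _ f, ht, mul_one, add_comm]

/-- If `f` and finitely many elements satisfy `f^N = s + a h`, then `s` is invertible in
`A⟨f⁻¹⟩†`, with inverse coming from an overconvergent series. -/
theorem Loc.exists_ofDagger_mul_eq_one [CompleteSpace K] (ha0 : a ≠ 0) (ha : ‖(a : K)‖ < 1)
    (hA : Function.Surjective (algebraMap (Dagger p K n) A)) {f s h : A} {N : ℕ}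
    (hs : f ^ N = s + constMap p n A a * h) :
    ∃ θ : Dagger p K (n + 1), algebraMap A (Loc p K n f) s * Loc.ofDagger f θ = 1 := by
  obtain ⟨H, rfl⟩ := hA h
  obtain ⟨S, hS⟩ := Dagger.exists_mul_eq_one ha0 ha
    (algebraMap (Dagger p K n) (Dagger p K (n + 1)) H * Dagger.X (Fin.last n) ^ N)
  have h1 := congrArg (Loc.ofDagger f) hS
  simp only [map_sub, map_mul, map_one, map_pow, Loc.ofDagger_X, Loc.ofDagger_algebraMap,
    Loc.ofDagger_const] at h1
  have h2 := congrArg (algebraMap A (Loc p K n f)) hs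
  rw [map_add, map_pow, map_mul] at h2
  refine ⟨Dagger.X (Fin.last n) ^ N * S, ?_⟩
  rw [map_mul, map_pow, Loc.ofDagger_X]
  have h3 := Loc.var_pow_mul (p := p) (K := K) (n := n) f N
  linear_combination h1 + Loc.ofDagger f S * h3 - (Loc.ofDagger f S * Loc.var f ^ N) * h2

/-- A high power of `∑ C_i F_i` is a combination of the `F_i^D` with controlled coefficients. -/
theorem exists_sum_mul_pow_eq {r : ℕ} {F c : Fin r → Dagger p K n} {ρ : ℝ} (hρ : 0 ≤ ρ)
    (hF : ∀ i, Bounded ρ 2 (F i).1) (hc : ∀ i, Bounded ρ 2 (c i).1) (D : ℕ) :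
    ∃ A : Fin r → Dagger p K n, (∀ i, Bounded ρ (2 ^ (2 * (r * D + 1) + D)) (A i).1) ∧
      (∑ i, c i * F i) ^ (r * D + 1) = ∑ i, A i * F i ^ D := by
  obtain ⟨A, hA, h⟩ := exists_sum_pow_eq (y := fun i => c i * F i) hρ (B := 4) (by norm_num)
    (fun i => ((hc i).mul hρ (hF i)).mono hρ le_rfl
      (by norm_num : (2 : ℝ) * 2 ≤ 4)) D
  refine ⟨fun i => A i * c i ^ D, fun i => ?_, ?_⟩
  · refine ((hA i).mul hρ ((hc i).pow hρ D)).mono hρ le_rfl ?_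
    rw [pow_add 2 (2 * (r * D + 1)), pow_mul 2 2 (r * D + 1), show (2 : ℝ) ^ 2 = 4 by norm_num]
  · rw [h]
    exact Finset.sum_congr rfl fun i _ => by rw [mul_pow]; ring

end Restriction

/-! ### Descent modulo powers of the uniformizer -/

section Descent

variable {p : ℕ} [Fact p.Prime] {K : Type*} [NormedField K] [IsUltrametricDist K] {n m : ℕ}
  {A : Type*} [CommRing A] [Algebra (Dagger p K n) A]
  {M : Type*} [AddCommGroup M] [Module A M] {a : RInt K}

theorem Dagger.exists_lastCoeff_dvd (ha0 : a ≠ 0) (J : ℕ) (w : Fin m → Dagger p K (n + 1)) :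
    ∃ D₀, ∀ D, D₀ ≤ D → ∀ i,
      algebraMap (RInt K) (Dagger p K n) a ^ J ∣ Dagger.lastCoeff p K n D (w i) := by
  obtain ⟨ρ, hρ, hw⟩ := exists_common_bound (p := p) (a := fun i => (w i).1)
    (fun i => (w i).2) (B := 2) (by norm_num)
  obtain ⟨D₀, hD₀⟩ := exists_le_pow_mul_pow ha0 hρ 2 J
  exact ⟨D₀, fun D hD i => Dagger.dvd_lastCoeff ha0 hρ.le (hD₀ D hD) (hw i) le_rfl⟩

/-- An element of `A⟨f⁻¹⟩† ⊗ M` whose restrictions are divisible by `a^J` is divisible by `a^J`, if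
the `g_i` generate the unit ideal of `A⟨f⁻¹⟩†`. -/
theorem mem_multiples_of_resTensor_mem (ha0 : a ≠ 0) (ha : ‖(a : K)‖ < 1)
    (hA : Function.Surjective (algebraMap (Dagger p K n) A))
    {e : Fin m → M} (he : Submodule.span A (Set.range e) = ⊤) {f : A} {r : ℕ} {g : Fin r → A}
    (hg : ∀ i, f ∣ g i) {c : Fin r → A} {b : Loc p K n f}
    (hb : algebraMap A (Loc p K n f) (∑ i, c i * g i) * b = 1) {J : ℕ} {x : Loc p K n f ⊗[A] M}
    (hx : ∀ i, Loc.resTensor hA (hg i) M x ∈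
      multiples (constMap p n A a ^ J) (Loc p K n (g i) ⊗[A] M)) :
    x ∈ multiples (constMap p n A a ^ J) (Loc p K n f ⊗[A] M) := by
  obtain ⟨F, hF⟩ := hA f
  obtain ⟨y, rfl⟩ := tensorTuple_surjective hA he f x
  -- In `M` itself, a power of each `g_i` makes the numerator of `x` divisible by `a^J`.
  have hloc : ∀ i, ∃ D₀, ∀ D, D₀ ≤ D →
      g i ^ D • evalTuple (A := A) e (fun j => Dagger.horner F D (y j)) ∈
        multiples (constMap p n A a ^ J) M := by
    intro i
    obtain ⟨G, hG, hres⟩ := exists_resTensor_tensorTuple hA e (hg i)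
    obtain ⟨x', hx'⟩ := hx i
    obtain ⟨t, rfl⟩ := tensorTuple_surjective hA he (g i) x'
    have h0 : tensorTuple e (g i) ((fun j => Dagger.scale G (y j)) -
        algebraMap (RInt K) (Dagger p K (n + 1)) a ^ J • t) = 0 := by
      rw [map_sub, tensorTuple_pow_smul, ← hres, sub_eq_zero]
      exact hx'.symm
    obtain ⟨w, hw⟩ := exists_evalTuple_horner hA he (F := F * G) (by rw [hG, map_mul, hF]) h0
    obtain ⟨D₀, hD₀⟩ := Dagger.exists_lastCoeff_dvd ha0 J w
    refine ⟨D₀, fun D hD => ?_⟩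
    have h1 : ∀ j, Dagger.horner (F * G) D (((fun j => Dagger.scale G (y j)) -
        algebraMap (RInt K) (Dagger p K (n + 1)) a ^ J • t) j) =
        G ^ D * Dagger.horner F D (y j) -
          algebraMap (RInt K) (Dagger p K n) a ^ J * Dagger.horner (F * G) D (t j) := by
      intro j
      rw [Pi.sub_apply, Pi.smul_apply, map_sub, Dagger.horner_scale ha0 ha, smul_eq_mul,
        ← Dagger.algebraMap_algebraMap_succ, ← map_pow, ← Algebra.smul_def, map_smul, smul_eq_mul]
    have h2 := hw D
    simp only [h1] at h2
    rw [evalTuple_sub, evalTuple_mul, sub_eq_iff_eq_add] at h2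
    have h3 : algebraMap (Dagger p K n) A (G ^ D) •
        evalTuple (A := A) e (fun j => Dagger.horner F D (y j)) ∈
        multiples (constMap p n A a ^ J) M := by
      rw [h2]
      exact Submodule.add_mem _ (Submodule.neg_mem _ (evalTuple_mem_multiples e (hD₀ D hD)))
        (evalTuple_mem_multiples e fun j => dvd_mul_right _ _)
    rw [map_pow] at h3
    rw [hG, mul_pow, mul_smul]
    exact Submodule.smul_mem _ _ h3
  choose D₁ hD₁ using hloc
  obtain ⟨ρ, hρ, hy⟩ := exists_common_bound (p := p) (a := fun i => (y i).1)
    (fun i => (y i).2) (B := 2) (by norm_num)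
  obtain ⟨D₂, hD₂⟩ := exists_le_pow_mul_pow ha0 hρ 2 J
  obtain ⟨D, hD, hD'⟩ : ∃ D, D₂ ≤ D ∧ ∀ i, D₁ i ≤ D :=
    ⟨D₂ + ∑ i, D₁ i, Nat.le_add_right _ _, fun i =>
      (Finset.single_le_sum (fun i _ => Nat.zero_le (D₁ i)) (Finset.mem_univ i)).trans
        (Nat.le_add_left _ _)⟩
  set u := evalTuple (A := A) e (fun j => Dagger.horner F D (y j)) with hu
  obtain ⟨q, hq⟩ : ∃ q : Fin r → A, (∑ i, c i * g i) ^ (r * D + 1) = ∑ i, q i * g i ^ D := by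
    choose F' hF' using fun i => hA (g i)
    choose C' hC' using fun i => hA (c i)
    obtain ⟨ρ₁, hρ₁, hb₁⟩ := exists_common_bound (p := p) (a := fun i => (F' i).1)
      (fun i => (F' i).2) (B := 2) (by norm_num)
    obtain ⟨ρ₂, hρ₂, hb₂⟩ := exists_common_bound (p := p) (a := fun i => (C' i).1)
      (fun i => (C' i).2) (B := 2) (by norm_num)
    have hρ0 : (0 : ℝ) ≤ min ρ₁ ρ₂ := le_min (by linarith) (by linarith)
    obtain ⟨q, -, hq⟩ := exists_sum_mul_pow_eq hρ0
      (fun i => (hb₁ i).mono hρ0 (min_le_left _ _) le_rfl)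
      (fun i => (hb₂ i).mono hρ0 (min_le_right _ _) le_rfl) D
    refine ⟨fun i => algebraMap _ A (q i), ?_⟩
    simpa only [map_pow, map_sum, map_mul, hF', hC'] using congrArg (algebraMap _ A) hq
  -- Hence so does a power of `∑ c_i g_i`, which is invertible in `A⟨f⁻¹⟩†`.
  have hsu : (∑ i, c i * g i) ^ (r * D + 1) • u ∈ multiples (constMap p n A a ^ J) M := by
    rw [hq, Finset.sum_smul]
    exact Submodule.sum_mem _ fun i _ => by
      rw [mul_smul]
      exact Submodule.smul_mem _ _ (hD₁ i D (hD' i))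
  have h4 := pow_smul_tensorTuple_sub_mem ha0 e hρ.le (hD₂ D hD) hF.symm hy
  have h5 : (∑ i, c i * g i) ^ (r * D + 1) • f ^ D • tensorTuple e f y ∈
      multiples (constMap p n A a ^ J) (Loc p K n f ⊗[A] M) := by
    have h6 := Submodule.smul_mem _ ((∑ i, c i * g i) ^ (r * D + 1)) h4
    have h7 := map_mem_multiples (TensorProduct.mk A (Loc p K n f) M 1) hsu
    rw [map_smul, TensorProduct.mk_apply] at h7
    rw [smul_sub] at h6
    have h8 := Submodule.add_mem _ h6 h7
    rwa [sub_add_cancel] at h8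
  refine mem_multiples_of_smul_mem (d := f ^ D) (b := Loc.var f ^ D)
    (by rw [map_pow]; exact Loc.var_pow_mul f D)
    (mem_multiples_of_smul_mem (b := b ^ (r * D + 1)) ?_ h5)
  rw [map_pow, ← mul_pow, hb, one_pow]

/-- A family that agrees on overlaps is the restriction, modulo `a^J`, of an element of
`A⟨f⁻¹⟩† ⊗ M` represented by series whose bound is exponential in the number `D` of terms needed
to represent the family modulo `a^J`. -/
theorem exists_approximate_glue (ha0 : a ≠ 0) (ha : ‖(a : K)‖ < 1)
    (hA : Function.Surjective (algebraMap (Dagger p K n) A))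
    (e : Fin m → M) {f : A} {r : ℕ} {g : Fin r → A} (hg : ∀ i, f ∣ g i)
    {ρ : ℝ} (hρ : 1 < ρ) {F c : Fin r → Dagger p K n}
    (hF : ∀ i, g i = algebraMap (Dagger p K n) A (F i))
    (hFb : ∀ i, Bounded ρ 2 (F i).1) (hcb : ∀ i, Bounded ρ 2 (c i).1)
    {θ : Dagger p K (n + 1)} (hθb : Bounded ρ 2 θ.1)
    (hθ : algebraMap A (Loc p K n f) (algebraMap (Dagger p K n) A (∑ i, c i * F i)) *
      Loc.ofDagger f θ = 1)
    {X : Fin r → Fin m → Dagger p K (n + 1)} (hXb : ∀ i l, Bounded ρ 2 (X i l).1)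
    {G G' : Fin r → Fin r → Dagger p K n}
    (hG : ∀ i j, g i * g j = g i * algebraMap (Dagger p K n) A (G i j))
    (hG' : ∀ i j, g i * g j = g j * algebraMap (Dagger p K n) A (G' i j))
    {w : Fin r → Fin r → Fin m → Dagger p K (n + 1)} (hwb : ∀ i j l, Bounded ρ 2 (w i j l).1)
    (hw : ∀ i j D, evalTuple (A := A) e (fun l => Dagger.horner (F i * G i j) D
      (Dagger.scale (G i j) (X i l) - Dagger.scale (G' i j) (X j l))) =
        - evalTuple (A := A) e (fun l => Dagger.lastCoeff p K n D (w i j l)))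
    {J D : ℕ} (hD : 2 ≤ ‖(a : K)‖ ^ J * ρ ^ D) :
    ∃ P : Fin m → Dagger p K (n + 1), (∀ l, Bounded ρ (2 ^ ((6 * r + 6) * D + 4)) (P l).1) ∧
      ∀ i, Loc.resTensor hA (hg i) M (tensorTuple e f P) - tensorTuple e (g i) (X i) ∈
        multiples (constMap p n A a ^ J) (Loc p K n (g i) ⊗[A] M) := by
  have hρ0 : 0 ≤ ρ := by linarith
  let u : Fin r → M := fun i => evalTuple (A := A) e (fun l => Dagger.horner (F i) D (X i l))
  -- `X i` is modulo `a^J` the fraction `u i / g_i^D`; a partition of unity in the `g_i^(2D)` glues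
  -- the fractions, as in the case of localizations of modules.
  obtain ⟨q, hqb, hq⟩ := exists_sum_mul_pow_eq hρ0 hFb hcb (2 * D)
  set L := r * (2 * D) + 1 with hL
  let U : Fin m → Dagger p K n := fun l =>
    ∑ i, q i * (F i ^ D * Dagger.horner (F i) D (X i l))
  have hU : evalTuple (A := A) e U =
      ∑ i, algebraMap (Dagger p K n) A (q i) • g i ^ D • u i := by
    simp only [U]
    rw [evalTuple_sum]
    refine Finset.sum_congr rfl fun i _ => ?_
    rw [evalTuple_mul, evalTuple_mul, map_pow, ← hF]
  have hUb : ∀ l, Bounded ρ (2 ^ (2 * L + 2 * D + (D + (D + 1)))) (U l).1 := by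
    intro l
    refine bounded_sum _ hρ0 (by positivity) fun i _ => ?_
    refine ((hqb i).mul hρ0 (((hFb i).pow hρ0 D).mul hρ0
      (Bounded.horner hρ.le (by norm_num) (hFb i) (hXb i l) D))).mono hρ0 le_rfl (le_of_eq ?_)
    ring
  -- On overlaps the numerators agree after clearing denominators.
  have hov : ∀ i j, g j ^ (2 * D) • g i ^ D • u i - g i ^ (2 * D) • g j ^ D • u j ∈
      multiples (constMap p n A a ^ J) M := by
    intro i j
    have h1 := hw i j D
    simp only [map_sub] at h1
    have hFG : algebraMap (Dagger p K n) A (F i * G i j) =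
        algebraMap (Dagger p K n) A (F j * G' i j) := by
      rw [map_mul, map_mul, ← hF, ← hF, ← hG, ← hG']
    rw [evalTuple_sub, evalTuple_horner_congr e hFG D (fun l => Dagger.scale (G' i j) (X j l))] at h1
    simp only [Dagger.horner_scale ha0 ha] at h1
    rw [evalTuple_mul, evalTuple_mul, map_pow, map_pow] at h1
    have h2 := Submodule.smul_mem _ ((g i * g j) ^ D) (Submodule.neg_mem _
      (evalTuple_lastCoeff_mem_multiples (A := A) ha0 e hρ.le hD (hwb i j)))
    rw [← h1, smul_sub, smul_smul, smul_smul] at h2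
    have h3 : (g i * g j) ^ D * algebraMap (Dagger p K n) A (G i j) ^ D =
        g j ^ (2 * D) * g i ^ D := by
      rw [mul_pow, mul_right_comm, ← mul_pow, ← hG]
      ring
    have h4 : (g i * g j) ^ D * algebraMap (Dagger p K n) A (G' i j) ^ D =
        g i ^ (2 * D) * g j ^ D := by
      rw [mul_pow, mul_assoc, ← mul_pow, ← hG']
      ring
    rwa [h3, h4, mul_smul, mul_smul] at h2
  set s := algebraMap (Dagger p K n) A (∑ i, c i * F i) with hs
  have hsL : s ^ L = ∑ i, algebraMap (Dagger p K n) A (q i) * g i ^ (2 * D) := by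
    rw [hs, ← map_pow, hq, map_sum]
    exact Finset.sum_congr rfl fun i _ => by rw [map_mul, map_pow, ← hF]
  have hUs : ∀ j, g j ^ (2 * D) • evalTuple (A := A) e U - s ^ L • g j ^ D • u j ∈
      multiples (constMap p n A a ^ J) M := by
    intro j
    rw [hU, hsL, Finset.smul_sum, Finset.sum_smul, ← Finset.sum_sub_distrib]
    refine Submodule.sum_mem _ fun i _ => ?_
    have := Submodule.smul_mem _ (algebraMap (Dagger p K n) A (q i)) (hov i j)
    rwa [smul_sub, smul_comm _ (g j ^ (2 * D)), smul_smul _ (g i ^ (2 * D))] at this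
  refine ⟨θ ^ L • fun l => algebraMap (Dagger p K n) (Dagger p K (n + 1)) (U l),
    fun l => ?_, fun j => ?_⟩
  · refine ((hθb.pow hρ0 L).mul hρ0 (hUb l).incl).mono hρ0 le_rfl ?_
    rw [← pow_add]
    refine pow_le_pow_right₀ (by norm_num) ?_
    rw [hL]
    nlinarith
  · set η := Loc.res hA (hg j) (Loc.ofDagger f θ) with hη
    have hη1 : algebraMap A (Loc p K n (g j)) s * η = 1 := by
      have := congrArg (Loc.res hA (hg j)) hθ
      rwa [map_mul, AlgHom.commutes, map_one] at this
    have hηL : algebraMap A (Loc p K n (g j)) (s ^ L) * η ^ L = 1 := by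
      rw [map_pow, ← mul_pow, hη1, one_pow]
    have h1 : Loc.resTensor hA (hg j) M (tensorTuple e f
        (θ ^ L • fun l => algebraMap (Dagger p K n) (Dagger p K (n + 1)) (U l))) =
        η ^ L • ((1 : Loc p K n (g j)) ⊗ₜ[A] evalTuple (A := A) e U) := by
      rw [map_smulₛₗ, tensorTuple_algebraMap, TensorProduct.smul_tmul', resTensor_tmul,
        TensorProduct.smul_tmul', smul_eq_mul, smul_eq_mul, mul_one, mul_one, map_pow, map_pow]
    rw [h1]
    refine mem_multiples_of_smul_mem (d := g j ^ (2 * D)) (b := Loc.var (g j) ^ (2 * D))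
      (by rw [map_pow]; exact Loc.var_pow_mul (g j) (2 * D)) ?_
    have h2 := smul_mem_multiples (η ^ L)
      (map_mem_multiples (TensorProduct.mk A (Loc p K n (g j)) M 1) (hUs j))
    rw [map_sub, map_smul, map_smul, map_smul, TensorProduct.mk_apply, TensorProduct.mk_apply,
      smul_sub, smul_comm _ (g j ^ (2 * D)), ← algebraMap_smul (Loc p K n (g j)) (s ^ L),
      smul_smul (η ^ L), mul_comm (η ^ L), hηL, one_smul] at h2
    have h3 := Submodule.smul_mem _ (g j ^ D)
      (pow_smul_tensorTuple_sub_mem ha0 e hρ.le hD (hF j) (hXb j))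
    rw [smul_sub, smul_smul, ← pow_add, ← two_mul] at h3
    have h4 := Submodule.sub_mem _ h2 h3
    rw [smul_sub (g j ^ (2 * D))]
    rwa [sub_sub_sub_cancel_right] at h4

end Descent

/-! ### Gluing over finitely generated modules -/

section Glue

variable {p : ℕ} [Fact p.Prime] {K : Type*} [NormedField K] [IsUltrametricDist K] {n m : ℕ}
  {A : Type*} [CommRing A] [Algebra (Dagger p K n) A]
  {M : Type*} [AddCommGroup M] [Module A M] {a : RInt K}

theorem multiples_pow_succ_le (c : A) (J : ℕ) :
    multiples (c ^ (J + 1)) M ≤ multiples (c ^ J) M := by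
  rintro x ⟨y, rfl⟩
  exact ⟨c • y, by rw [LinearMap.lsmul_apply, LinearMap.lsmul_apply, pow_succ, mul_smul]⟩

variable [CompleteSpace K] [IsNoetherianRing (RInt K)]

/-- An `a`-adic Cauchy sequence in `A⟨f⁻¹⟩† ⊗ M` converges if its terms are represented by series
whose bounds on a common polydisc grow at most geometrically: the successive differences, divided
by powers of `a`, are then represented by series with geometric bounds as well, and can be
summed in `T_{n+1}†`. -/
theorem exists_limit_of_bounded (ha0 : a ≠ 0) (ha : ‖(a : K)‖ < 1)
    (hA : Function.Surjective (algebraMap (Dagger p K n) A))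
    {e : Fin m → M} (he : Submodule.span A (Set.range e) = ⊤) (f : A) :
    ∃ ρ₀ : ℝ, 1 < ρ₀ ∧ ∀ ρ, 1 < ρ → ρ ≤ ρ₀ → ∀ (C B : ℝ) (P : ℕ → Fin m → Dagger p K (n + 1)),
      1 ≤ C → 1 ≤ B → (∀ J l, Bounded ρ (C * B ^ J) (P J l).1) →
      (∀ J, tensorTuple e f (P (J + 1)) - tensorTuple e f (P J) ∈
        multiples (constMap p n A a ^ J) (Loc p K n f ⊗[A] M)) →
      ∃ z : Loc p K n f ⊗[A] M, ∀ J, z - tensorTuple e f (P J) ∈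
        multiples (constMap p n A a ^ J) (Loc p K n f ⊗[A] M) := by
  obtain ⟨ρ₀, hρ₀, H⟩ := exists_bounded_division ha0 ha
    (LinearMap.ker (tensorTuple (p := p) (K := K) (n := n) e f))
  refine ⟨ρ₀, hρ₀, fun ρ hρ hρρ C B P hC hB hP hcauchy => ?_⟩
  obtain ⟨B', hB', hdiv⟩ := H ρ hρ hρρ
  have hρ0 : 0 ≤ ρ := by linarith
  have hstep : ∀ J, ∃ z : Fin m → Dagger p K (n + 1),
      (∀ l, Bounded ρ (C * B * (B * B') ^ J) (z l).1) ∧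
      tensorTuple e f (P (J + 1)) - tensorTuple e f (P J) =
        constMap p n A a ^ J • tensorTuple e f z := by
    intro J
    have hBJ : 1 ≤ B ^ J := one_le_pow₀ hB
    have hCB : 1 ≤ C * B ^ (J + 1) := one_le_mul_of_one_le_of_one_le hC (one_le_pow₀ hB)
    have hle : C * B ^ J ≤ C * B ^ (J + 1) :=
      mul_le_mul_of_nonneg_left (pow_le_pow_right₀ hB (Nat.le_succ J)) (by linarith)
    obtain ⟨x, hx⟩ := hcauchy J
    obtain ⟨t, rfl⟩ := tensorTuple_surjective hA he f x
    obtain ⟨z, hz, hz'⟩ := hdiv J (C * B ^ (J + 1)) (P (J + 1) - P J) hCB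
      (fun l => (hP (J + 1) l).sub hρ0 ((hP J l).mono hρ0 le_rfl hle))
      ⟨t, by
        rw [LinearMap.mem_ker, map_sub, map_sub, tensorTuple_pow_smul, ← hx, sub_eq_zero]
        rfl⟩
    refine ⟨z, fun l => ?_, ?_⟩
    · refine (hz l).mono hρ0 le_rfl (le_of_eq ?_)
      rw [mul_pow, pow_succ]
      ring
    · rwa [LinearMap.mem_ker, map_sub, map_sub, tensorTuple_pow_smul, sub_eq_zero] at hz'
  choose z hzb hz using hstep
  have hsum : ∀ l, ∃ s : Dagger p K (n + 1), ∀ J, ∃ t, s =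
      ∑ j ∈ Finset.range J, algebraMap (RInt K) (Dagger p K (n + 1)) a ^ j * z j l +
        algebraMap (RInt K) (Dagger p K (n + 1)) a ^ J * t := fun l =>
    Dagger.exists_series_sum ha0 ha hρ (one_le_mul_of_one_le_of_one_le hB hB')
      (fun j => z j l) fun j => hzb j l
  choose s hs using hsum
  refine ⟨tensorTuple e f (P 0 + s), fun J => ?_⟩
  choose t ht using fun l => hs l J
  have htel : ∀ J, tensorTuple e f (P J) = tensorTuple e f (P 0) +
      ∑ j ∈ Finset.range J, constMap p n A a ^ j • tensorTuple e f (z j) := by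
    intro J
    induction J with
    | zero => simp
    | succ J ih => rw [Finset.sum_range_succ, ← add_assoc, ← ih, ← hz, add_sub_cancel]
  have hs' : s = ∑ j ∈ Finset.range J, algebraMap (RInt K) (Dagger p K (n + 1)) a ^ j • z j +
      algebraMap (RInt K) (Dagger p K (n + 1)) a ^ J • t := by
    funext l
    rw [ht l, Pi.add_apply, Finset.sum_apply]
    rfl
  refine ⟨tensorTuple e f t, ?_⟩
  rw [htel J, hs', map_add, map_add, map_sum, tensorTuple_pow_smul]
  simp only [tensorTuple_pow_smul]
  rw [add_sub_add_left_eq_sub, add_sub_cancel_left]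
  rfl

variable {f : A} {r : ℕ} {g c : Fin r → A} {N : ℕ} {h : A}

/-- Injectivity of the augmentation for finitely generated modules. -/
theorem eq_zero_of_resTensor_eq_zero (ha0 : a ≠ 0) (ha : ‖(a : K)‖ < 1)
    (hA : Function.Surjective (algebraMap (Dagger p K n) A))
    {e : Fin m → M} (he : Submodule.span A (Set.range e) = ⊤) (hg : ∀ i, f ∣ g i)
    (hs : f ^ N = ∑ i, c i * g i + constMap p n A a * h) {x : Loc p K n f ⊗[A] M}
    (hx : ∀ i, Loc.resTensor hA (hg i) M x = 0) : x = 0 := by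
  obtain ⟨θ, hθ⟩ := Loc.exists_ofDagger_mul_eq_one ha0 ha hA hs
  refine eq_zero_of_forall_mem_multiples ha0 ha hA he fun J =>
    mem_multiples_of_resTensor_mem ha0 ha hA he hg hθ fun i => ?_
  rw [hx i]
  exact Submodule.zero_mem _

/-- The gluing property for finitely generated modules. -/
theorem exists_resTensor_eq (ha0 : a ≠ 0) (ha : ‖(a : K)‖ < 1)
    (hA : Function.Surjective (algebraMap (Dagger p K n) A))
    {e : Fin m → M} (he : Submodule.span A (Set.range e) = ⊤) (hg : ∀ i, f ∣ g i)
    (hs : f ^ N = ∑ i, c i * g i + constMap p n A a * h)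
    {x : ∀ i, Loc p K n (g i) ⊗[A] M}
    (hx : ∀ i j, Loc.resTensor hA (dvd_mul_right (g i) (g j)) M (x i) =
      Loc.resTensor hA (dvd_mul_left (g j) (g i)) M (x j)) :
    ∃ z : Loc p K n f ⊗[A] M, ∀ i, Loc.resTensor hA (hg i) M z = x i := by
  obtain ⟨θ, hθ⟩ := Loc.exists_ofDagger_mul_eq_one ha0 ha hA hs
  choose F hF using fun i => hA (g i)
  choose c' hc' using fun i => hA (c i)
  choose X hX using fun i => tensorTuple_surjective hA he (g i) (x i)
  choose G hG hGres using fun i j =>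
    exists_resTensor_tensorTuple (M := M) hA e (dvd_mul_right (g i) (g j))
  choose G' hG' hGres' using fun i j =>
    exists_resTensor_tensorTuple (M := M) hA e (dvd_mul_left (g j) (g i))
  have hzero : ∀ i j, tensorTuple e (g i * g j) (fun l =>
      Dagger.scale (G i j) (X i l) - Dagger.scale (G' i j) (X j l)) = 0 := by
    intro i j
    have h1 := hx i j
    rw [← hX i, ← hX j, hGres, hGres', ← sub_eq_zero, ← map_sub] at h1
    exact h1
  choose w hw using fun i j => exists_evalTuple_horner hA he (F := F i * G i j)
    (by rw [map_mul, hF, ← hG]) (hzero i j)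
  obtain ⟨ρ₀, hρ₀, hlim⟩ := exists_limit_of_bounded ha0 ha hA he f
  obtain ⟨ρ₁, hρ₁, hFb⟩ := exists_common_bound (p := p) (a := fun i => (F i).1)
    (fun i => (F i).2) (B := 2) (by norm_num)
  obtain ⟨ρ₂, hρ₂, hcb⟩ := exists_common_bound (p := p) (a := fun i => (c' i).1)
    (fun i => (c' i).2) (B := 2) (by norm_num)
  obtain ⟨ρ₃, hρ₃, hXb⟩ := exists_common_bound (p := p)
    (a := fun q : Fin r × Fin m => (X q.1 q.2).1) (fun q => (X q.1 q.2).2) (B := 2) (by norm_num)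
  obtain ⟨ρ₄, hρ₄, hwb⟩ := exists_common_bound (p := p)
    (a := fun q : Fin r × Fin r × Fin m => (w q.1 q.2.1 q.2.2).1)
    (fun q => (w q.1 q.2.1 q.2.2).2) (B := 2) (by norm_num)
  obtain ⟨ρ₅, hρ₅, hθb⟩ := exists_common_bound (p := p) (a := fun _ : Unit => θ.1)
    (fun _ => θ.2) (B := 2) (by norm_num)
  obtain ⟨ρ, hρ, h0, h1, h2, h3, h4, h5⟩ : ∃ ρ : ℝ, 1 < ρ ∧ ρ ≤ ρ₀ ∧ ρ ≤ ρ₁ ∧ ρ ≤ ρ₂ ∧ ρ ≤ ρ₃ ∧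
      ρ ≤ ρ₄ ∧ ρ ≤ ρ₅ :=
    ⟨min ρ₀ (min ρ₁ (min ρ₂ (min ρ₃ (min ρ₄ ρ₅)))), by simp [*], by simp, by simp, by simp,
      by simp, by simp, by simp⟩
  have hρ0 : 0 ≤ ρ := by linarith
  have hs' : algebraMap (Dagger p K n) A (∑ i, c' i * F i) = ∑ i, c i * g i := by
    simp only [map_sum, map_mul, hc', hF]
  obtain ⟨d, hd⟩ : ∃ d : ℕ, 2 ≤ ‖(a : K)‖ * ρ ^ d := by
    obtain ⟨d, hd⟩ := exists_le_pow_mul_pow ha0 hρ 2 1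
    exact ⟨d, by simpa using hd d le_rfl⟩
  -- The number of terms needed for a precision of `a^(J+1)` is linear in `J`.
  have hdJ : ∀ J : ℕ, 2 ≤ ‖(a : K)‖ ^ (J + 1) * ρ ^ (d * (J + 1)) := by
    intro J
    rw [pow_mul, ← mul_pow]
    exact hd.trans (le_self_pow₀ (by linarith) (Nat.succ_ne_zero J))
  have hP := fun J => exists_approximate_glue ha0 ha hA e hg hρ (fun i => (hF i).symm)
    (fun i => (hFb i).mono hρ0 h1 le_rfl) (fun i => (hcb i).mono hρ0 h2 le_rfl)
    ((hθb ()).mono hρ0 h5 le_rfl) (by rw [hs']; exact hθ)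
    (fun i l => (hXb (i, l)).mono hρ0 h3 le_rfl) hG hG'
    (fun i j l => (hwb (i, j, l)).mono hρ0 h4 le_rfl) hw (hdJ J)
  choose P hPb hPg using hP
  have hcauchy : ∀ J, tensorTuple e f (P (J + 1)) - tensorTuple e f (P J) ∈
      multiples (constMap p n A a ^ J) (Loc p K n f ⊗[A] M) := by
    intro J
    refine mem_multiples_of_resTensor_mem ha0 ha hA he hg hθ fun i => ?_
    rw [map_sub]
    have := Submodule.sub_mem _ (multiples_pow_succ_le _ _ (hPg (J + 1) i)) (hPg J i)
    rw [sub_sub_sub_cancel_right] at this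
    exact multiples_pow_succ_le _ _ this
  obtain ⟨z, hz⟩ := hlim ρ hρ h0 (2 ^ ((6 * r + 6) * d + 4)) (2 ^ ((6 * r + 6) * d)) P
    (one_le_pow₀ (by norm_num)) (one_le_pow₀ (by norm_num))
    (fun J l => (hPb J l).mono hρ0 le_rfl (le_of_eq (by ring))) hcauchy
  refine ⟨z, fun i => sub_eq_zero.1 (eq_zero_of_forall_mem_multiples ha0 ha hA he fun J => ?_)⟩
  have h6 := map_mem_multiples (Loc.resTensor hA (hg i) M) (hz J)
  rw [map_sub] at h6
  have h7 := Submodule.add_mem _ h6 (multiples_pow_succ_le _ _ (hPg J i))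
  rwa [sub_add_sub_cancel, hX] at h7

end Glue

/-! ### Reduction to finitely generated modules -/

section Reduction

variable {A : Type*} [CommRing A] {M : Type*} [AddCommGroup M] [Module A M]

theorem exists_fg_mem_range_lTensor {B : Type*} [AddCommGroup B] [Module A B] (x : B ⊗[A] M) :
    ∃ Q : Submodule A M, Q.FG ∧ x ∈ LinearMap.range (Q.subtype.lTensor B) := by
  obtain ⟨Q, hQ, t, ht⟩ := TensorProduct.exists_of_fg (TensorProduct.comm A B M x)
  refine ⟨Q, hQ, TensorProduct.comm A Q B t, ?_⟩
  rw [← LinearMap.comm_comp_rTensor_comp_comm_eq]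
  simp [ht]

theorem exists_fg_lTensor_inclusion_eq_zero {B : Type*} [AddCommGroup B] [Module A B]
    {P : Submodule A M} (hP : P.FG) {x : B ⊗[A] P} (hx : P.subtype.lTensor B x = 0) :
    ∃ (Q : Submodule A M) (hPQ : P ≤ Q), Q.FG ∧ (Submodule.inclusion hPQ).lTensor B x = 0 := by
  have h : P.subtype.rTensor B (TensorProduct.comm A B P x) = 0 := by
    rw [← LinearMap.comm_comp_lTensor_comp_comm_eq]
    simp [hx]
  obtain ⟨Q, hPQ, hQ, h⟩ := TensorProduct.eq_zero_of_fg_of_subtype_eq_zero hP h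
  refine ⟨Q, hPQ, hQ, ?_⟩
  rw [← LinearMap.comm_comp_rTensor_comp_comm_eq]
  simp [h]

theorem lTensor_subtype_inclusion {B : Type*} [AddCommGroup B] [Module A B]
    {P Q : Submodule A M} (hPQ : P ≤ Q) (x : B ⊗[A] P) :
    Q.subtype.lTensor B ((Submodule.inclusion hPQ).lTensor B x) = P.subtype.lTensor B x := by
  rw [← LinearMap.comp_apply, ← LinearMap.lTensor_comp, Submodule.subtype_comp_inclusion]

theorem lTensor_inclusion_inclusion {B : Type*} [AddCommGroup B] [Module A B]
    {P Q S : Submodule A M} (hPQ : P ≤ Q) (hQS : Q ≤ S) (x : B ⊗[A] P) :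
    (Submodule.inclusion hQS).lTensor B ((Submodule.inclusion hPQ).lTensor B x) =
      (Submodule.inclusion (hPQ.trans hQS)).lTensor B x := by
  rw [← LinearMap.comp_apply, ← LinearMap.lTensor_comp]
  rfl

/-- Finitely many elements of modules `B_i ⊗ M` come from one finitely generated submodule
of `M`. -/
theorem exists_fg_forall_mem_range_lTensor {ι : Type*} [Finite ι] {B : ι → Type*}
    [∀ i, AddCommGroup (B i)] [∀ i, Module A (B i)] (x : ∀ i, B i ⊗[A] M) :
    ∃ Q : Submodule A M, Q.FG ∧ ∀ i, ∃ y : B i ⊗[A] Q, Q.subtype.lTensor (B i) y = x i := by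
  choose Q hQ y hy using fun i => exists_fg_mem_range_lTensor (x i)
  refine ⟨⨆ i, Q i, Submodule.fg_iSup _ hQ, fun i =>
    ⟨(Submodule.inclusion (le_iSup Q i)).lTensor (B i) (y i), ?_⟩⟩
  rw [lTensor_subtype_inclusion, hy]

/-- Finitely many elements of modules `B_i ⊗ P` that vanish in `B_i ⊗ M` vanish over one finitely
generated submodule of `M`. -/
theorem exists_fg_forall_lTensor_inclusion_eq_zero {ι : Type*} [Finite ι] {B : ι → Type*}
    [∀ i, AddCommGroup (B i)] [∀ i, Module A (B i)] {P : Submodule A M} (hP : P.FG)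
    {x : ∀ i, B i ⊗[A] P} (hx : ∀ i, P.subtype.lTensor (B i) (x i) = 0) :
    ∃ (Q : Submodule A M) (hPQ : P ≤ Q), Q.FG ∧
      ∀ i, (Submodule.inclusion hPQ).lTensor (B i) (x i) = 0 := by
  choose Q hPQ hQ h using fun i => exists_fg_lTensor_inclusion_eq_zero hP (hx i)
  refine ⟨P ⊔ ⨆ i, Q i, le_sup_left, hP.sup (Submodule.fg_iSup _ hQ), fun i => ?_⟩
  rw [← lTensor_inclusion_inclusion (hPQ i) ((le_iSup Q i).trans le_sup_right), h, map_zero]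

variable {p : ℕ} [Fact p.Prime] {K : Type*} [NormedField K] [IsUltrametricDist K] {n : ℕ}
  [Algebra (Dagger p K n) A]

theorem resTensor_lTensor (hA : Function.Surjective (algebraMap (Dagger p K n) A)) {b c : A}
    (h : b ∣ c) {M' : Type*} [AddCommGroup M'] [Module A M'] (l : M' →ₗ[A] M)
    (x : Loc p K n b ⊗[A] M') :
    Loc.resTensor hA h M (l.lTensor _ x) = l.lTensor _ (Loc.resTensor hA h M' x) := by
  rw [Loc.resTensor, Loc.resTensor, ← LinearMap.comp_apply, ← LinearMap.comp_apply,
    LinearMap.rTensor_comp_lTensor, LinearMap.lTensor_comp_rTensor]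

variable [CompleteSpace K] [IsNoetherianRing (RInt K)] {a : RInt K}

/-- Restriction is transitive, by uniqueness of `A`-algebra homomorphisms between localizations. -/
theorem resTensor_resTensor (ha0 : a ≠ 0) (ha : ‖(a : K)‖ < 1)
    (hA : Function.Surjective (algebraMap (Dagger p K n) A)) {b c d : A} (hbc : b ∣ c)
    (hcd : c ∣ d) (x : Loc p K n b ⊗[A] M) :
    Loc.resTensor hA hcd M (Loc.resTensor hA hbc M x) =
      Loc.resTensor hA (hbc.trans hcd) M x := by
  rw [Loc.resTensor, Loc.resTensor, Loc.resTensor, ← LinearMap.comp_apply, ← LinearMap.rTensor_comp,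
    ← Loc.algHom_ext ha0 ha hA ((Loc.res hA hcd).comp (Loc.res hA hbc))
      (Loc.res hA (hbc.trans hcd))]
  rfl

variable {f : A} {r : ℕ} {g c : Fin r → A} {N : ℕ} {h : A}

theorem injective_cechAug (ha0 : a ≠ 0) (ha : ‖(a : K)‖ < 1)
    (hA : Function.Surjective (algebraMap (Dagger p K n) A)) (hg : ∀ i, f ∣ g i)
    (hs : f ^ N = ∑ i, c i * g i + constMap p n A a * h) :
    Function.Injective (cechAug hA M hg) := by
  refine (injective_iff_map_eq_zero _).2 fun x hx => ?_
  obtain ⟨P, hP, y, rfl⟩ := exists_fg_mem_range_lTensor x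
  obtain ⟨Q, hPQ, hQ, h0⟩ := exists_fg_forall_lTensor_inclusion_eq_zero hP
    (x := fun i => Loc.resTensor hA (hg i) P y) fun i => by
      rw [← resTensor_lTensor]
      exact congrFun hx i
  have : Module.Finite A Q := Module.Finite.iff_fg.2 hQ
  obtain ⟨m, e, he⟩ := Module.Finite.exists_fin (R := A) (M := Q)
  have h1 : (Submodule.inclusion hPQ).lTensor _ y = 0 :=
    eq_zero_of_resTensor_eq_zero ha0 ha hA he hg hs fun i => by rw [resTensor_lTensor, h0]
  rw [← lTensor_subtype_inclusion hPQ, h1, map_zero]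

theorem range_cechAug (ha0 : a ≠ 0) (ha : ‖(a : K)‖ < 1)
    (hA : Function.Surjective (algebraMap (Dagger p K n) A)) (hg : ∀ i, f ∣ g i)
    (hs : f ^ N = ∑ i, c i * g i + constMap p n A a * h) :
    LinearMap.range (cechAug hA M hg) = LinearMap.eqLocus (cechLeft hA M g) (cechRight hA M g) := by
  apply le_antisymm
  · rintro _ ⟨x, rfl⟩
    refine LinearMap.mem_eqLocus.2 (funext fun q => ?_)
    change Loc.resTensor hA _ M (Loc.resTensor hA _ M x) =
      Loc.resTensor hA _ M (Loc.resTensor hA _ M x)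
    rw [resTensor_resTensor ha0 ha, resTensor_resTensor ha0 ha]
  · intro x hx
    obtain ⟨P, hP, hy⟩ := exists_fg_forall_mem_range_lTensor x
    choose y hy using hy
    obtain ⟨Q, hPQ, hQ, h0⟩ := exists_fg_forall_lTensor_inclusion_eq_zero hP
      (x := fun q : Fin r × Fin r => Loc.resTensor hA (dvd_mul_right (g q.1) (g q.2)) P (y q.1) -
        Loc.resTensor hA (dvd_mul_left (g q.2) (g q.1)) P (y q.2)) fun q => by
      rw [map_sub, ← resTensor_lTensor, ← resTensor_lTensor, hy, hy, sub_eq_zero]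
      exact congrFun (LinearMap.mem_eqLocus.1 hx) q
    have : Module.Finite A Q := Module.Finite.iff_fg.2 hQ
    obtain ⟨m, e, he⟩ := Module.Finite.exists_fin (R := A) (M := Q)
    obtain ⟨z, hz⟩ := exists_resTensor_eq ha0 ha hA he hg hs
      (x := fun i => (Submodule.inclusion hPQ).lTensor _ (y i)) fun i j => by
        rw [resTensor_lTensor, resTensor_lTensor, ← sub_eq_zero, ← map_sub]
        exact h0 (i, j)
    refine ⟨Q.subtype.lTensor _ z, funext fun i => ?_⟩
    change Loc.resTensor hA (hg i) M _ = x i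
    rw [resTensor_lTensor, hz, lTensor_subtype_inclusion, hy]

end Reduction

end DaggerAlgebra

end

open DaggerAlgebra in
theorem proposition5 (p : ℕ) [Fact p.Prime]
    (K : Type*) [NormedField K] [NormedAlgebra ℚ_[p] K] [FiniteDimensional ℚ_[p] K]
    [IsUltrametricDist K]
    (n : ℕ) (A : Type*) [CommRing A] [Algebra (RInt K) A] [Algebra (Dagger p K n) A]
    [IsScalarTower (RInt K) (Dagger p K n) A]
    (hA : Function.Surjective (algebraMap (Dagger p K n) A))
    [Module.Flat (RInt K) A]
    (f : A) (r : ℕ) (g : Fin r → A) (hg : ∀ i, f ∣ g i)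
    (hrad : algebraMap A (A ⊗[RInt K] IsLocalRing.ResidueField (RInt K)) f ∈
      (Ideal.span (Set.range fun i =>
        algebraMap A (A ⊗[RInt K] IsLocalRing.ResidueField (RInt K)) (g i))).radical)
    (M : Type*) [AddCommGroup M] [Module A M] :
    Function.Injective (cechAug hA M hg) ∧
      LinearMap.range (cechAug hA M hg) =
        LinearMap.eqLocus (cechLeft hA M g) (cechRight hA M g) := by
  obtain ⟨a, ha0, ha, hmax⟩ := exists_uniformizer (p := p) (K := K)
  have : CompleteSpace K := FiniteDimensional.complete ℚ_[p] K
  have : IsNoetherianRing (RInt K) := isNoetherianRing_of_uniformizer ha0 ha hmax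
  obtain ⟨N, c, h, hs⟩ := exists_pow_eq_of_mem_radical ha0 hmax hrad
  rw [IsScalarTower.algebraMap_apply (RInt K) (Dagger p K n) A] at hs
  exact ⟨injective_cechAug ha0 ha hA hg hs, range_cechAug ha0 ha hA hg hs⟩
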